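/- Let $\Theta_2$ be Joyal's 2-cell category: its objects are $[n;\mathbf q]=[n;q_1,\dots,q_n]$ with $n,q_i\in\mathbb N$, and a morphism $[\alpha;\boldsymbol\alpha]:[m;\mathbf p]\to[n;\mathbf q]$ consists of an order-preserving map $\alpha:[m]\to[n]$ and order-preserving maps $\alpha_k:[p_\ell]\to[q_k]$ for all $k,\ell$ with $\alpha(\ell-1)<k\le\alpha(\ell)$. Cellular sets are presheaves of sets on $\Theta_2$, and $\Theta_2[n;\mathbf q]$ is the representable one. A *hyperface* of $[n;\mathbf q]$ is a morphism $[\alpha;\boldsymbol\alpha]:[m;\mathbf p]\to[n;\mathbf q]$ such that $\alpha$ is injective, for each $\ell$ the family $\{\alpha_k:\alpha(\ell-1)<k\le\alpha(\ell)\}$ is jointly injective, and $m+\sum_\ell p_\ell+1=n+\sum_k q_k$. For a simplicial set $X$ over $\Delta[n]$ and simplicial sets $S_1,\dots,S_n$, let $\square_n(X;S_1,\dots,S_n)$ be the cellular set whose cells of shape $[m;\mathbf p]$ are the pairs consisting of an $m$-simplex $x$ of $X$, with image $\alpha:[m]\to[n]$ in $\Delta[n]$, and a family of $p_\ell$-simplices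 of $S_k$, one for each pair $(k,\ell)$ with $\alpha(\ell-1)<k\le\alpha(\ell)$; then $\square_n(\Delta[n];\Delta[q_1],\dots,\Delta[q_n])\cong\Theta_2[n;\mathbf q]$. Let $\hat\square_n$ be its $(n+1)$-ary Leibniz construction: it sends maps $f_i:X_i^0\to X_i^1$ ($0\le i\le n$, with $f_0$ over $\Delta[n]$) to the canonical map from the colimit of $\square_n(X_0^{\epsilon_0};X_1^{\epsilon_1},\dots,X_n^{\epsilon_n})$ over all $\epsilon\in\{0\to1\}^{n+1}$, $\epsilon\ne(1,\dots,1)$, to $\square_n(X_0^1;X_1^1,\dots,X_n^1)$. Put: * $\mathcal H_h$: the set of (Oury) inner horizontal horn inclusions $\hat\square_n(\Lambda^k[n]\hookrightarrow\Delta[n];\ \partial\Delta[q_1]\hookrightarrow\Delta[q_1],\dots,\partial\Delta[q_n]\hookrightarrow\Delta[q_n])$, for $[n;\mathbf q]\in\Theta_2$ and $1\le k\le n-1$; * $\mathcal H_v$: the set of inner vertical horn inclusions $\hat\square_n(\partial\Delta[n]\hookrightarrow\Delta[n];\ g_1,\dots,g_n)$, for $[n;\mathbf q]\in\Theta_2$,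 $1\le k\le n$ and $1\le i\le q_k-1$, where $g_k$ is $\Lambda^i[q_k]\hookrightarrow\Delta[q_k]$ and $g_j$ is $\partial\Delta[q_j]\hookrightarrow\Delta[q_j]$ for $j\neq k$; * $\mathcal H'_h$: the set of alternative inner horizontal horn inclusions $\Lambda_h^{k;\langle\beta,\beta'\rangle}[n;\mathbf q]\hookrightarrow\Theta_2[n;\mathbf q]$, for $[n;\mathbf q]\in\Theta_2$, $1\le k\le n-1$ and a $(q_k,q_{k+1})$-shuffle $\langle\beta,\beta'\rangle$ (surjections $\beta:[q_k+q_{k+1}]\to[q_k]$ and $\beta':[q_k+q_{k+1}]\to[q_{k+1}]$ in $\Delta$ with $\beta(i)+\beta'(i)=i$ for all $i$). Here $\Lambda_h^{k;\langle\beta,\beta'\rangle}[n;\mathbf q]\subset\Theta_2[n;\mathbf q]$ is the cellular subset generated by all hyperfaces of $[n;\mathbf q]$ except the hyperface $[\delta^k;\boldsymbol\alpha]:[n-1;q_1,\dots,q_{k-1},q_k+q_{k+1},q_{k+2},\dots,q_n]\to[n;\mathbf q]$ with $\alpha_k=\beta$, $\alpha_{k+1}=\beta'$ and $\alpha_j=\mathrm{id}$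 for $j\ne k,k+1$. For a set $\mathcal S$ of maps of cellular sets, let $\mathrm{cell}(\mathcal S)$ denote the closure of $\mathcal S$ under transfinite composition and pushouts along arbitrary maps. **Lemma.** Every map in $\mathcal H_h$ is contained in $\mathrm{cell}(\mathcal H'_h\cup\mathcal H_v)$. -/

import Mathlib

open CategoryTheory CategoryTheory.Limits Opposite Simplicial

/-! ### Simplicial operators and shuffles -/

/-- For a simplicial operator `α : [m] → [n]`, the `l`-th edge `{l, l + 1}` of `[m]` covers the
`k`-th edge `{k, k + 1}` of `[n]` if `α l ≤ k` and `k + 1 ≤ α (l + 1)`. (Edges are numbered from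
`0`; for edges numbered from `1` this is the condition `α (l - 1) < k ≤ α l`.) -/
def Covers {m n : ℕ} (α : ⦋m⦌ ⟶ ⦋n⦌) (l : Fin m) (k : Fin n) : Prop :=
  α.toOrderHom l.castSucc ≤ k.castSucc ∧ k.succ ≤ α.toOrderHom l.succ

theorem Covers.unique {m n : ℕ} {α : ⦋m⦌ ⟶ ⦋n⦌} {l l' : Fin m} {k : Fin n}
    (h : Covers α l k) (h' : Covers α l' k) : l = l' := by
  by_contra hne
  rcases lt_or_gt_of_ne hne with hlt | hlt
  · have h1 := α.toOrderHom.monotone (show l.succ ≤ l'.castSucc from hlt)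
    exact absurd (h.2.trans (h1.trans h'.1)) (by simp [Fin.le_def])
  · have h1 := α.toOrderHom.monotone (show l'.succ ≤ l.castSucc from hlt)
    exact absurd (h'.2.trans (h1.trans h.1)) (by simp [Fin.le_def])

theorem Covers.eq_of_id {n : ℕ} {l k : Fin n} (h : Covers (𝟙 ⦋n⦌) l k) : l = k := by
  obtain ⟨h1, h2⟩ := h
  simp only [SimplexCategory.id_toOrderHom, OrderHom.id_coe, id_eq, Fin.le_def,
    Fin.val_castSucc, Fin.val_succ] at h1 h2
  apply Fin.ext
  omega

theorem Covers.id {n : ℕ} (k : Fin n) : Covers (𝟙 ⦋n⦌) k k := by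
  constructor <;> exact le_refl _

theorem Covers.comp {m n r : ℕ} {α : ⦋m⦌ ⟶ ⦋n⦌} {β : ⦋n⦌ ⟶ ⦋r⦌} {l : Fin m} {k : Fin n}
    {j : Fin r} (h : Covers α l k) (h' : Covers β k j) : Covers (α ≫ β) l j :=
  ⟨(β.toOrderHom.monotone h.1).trans h'.1, h'.2.trans (β.toOrderHom.monotone h.2)⟩

theorem Covers.exists_mid {m n r : ℕ} {α : ⦋m⦌ ⟶ ⦋n⦌} {β : ⦋n⦌ ⟶ ⦋r⦌} {l : Fin m} {j : Fin r}
    (h : Covers (α ≫ β) l j) : ∃ k : Fin n, Covers α l k ∧ Covers β k j := by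
  obtain ⟨h1, h2⟩ := h
  change β.toOrderHom (α.toOrderHom l.castSucc) ≤ _ at h1
  change _ ≤ β.toOrderHom (α.toOrderHom l.succ) at h2
  have key : ∀ (d a b : ℕ) (ha : a < n + 1) (hb : b < n + 1), b = a + d →
      β.toOrderHom ⟨a, ha⟩ ≤ j.castSucc → j.succ ≤ β.toOrderHom ⟨b, hb⟩ →
      ∃ k : Fin n, a ≤ k.1 ∧ k.1 < b ∧ Covers β k j := by
    intro d
    induction d with
    | zero =>
      intro a b ha hb hab h1 h2
      obtain rfl : b = a := hab
      exact absurd (h2.trans h1) (by simp [Fin.le_def])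
    | succ d ih =>
      intro a b ha hb hab h1 h2
      have hn : a < n := by omega
      by_cases hc : j.succ ≤ β.toOrderHom ⟨a + 1, show a + 1 < n + 1 by omega⟩
      · exact ⟨⟨a, hn⟩, le_rfl, show a < b by omega, h1, hc⟩
      · have hc' : β.toOrderHom ⟨a + 1, show a + 1 < n + 1 by omega⟩ ≤ j.castSucc := by
          rw [Fin.le_def] at hc ⊢
          simp only [Fin.val_succ, Fin.val_castSucc] at hc ⊢
          exact Nat.lt_succ_iff.mp (not_le.mp hc)
        obtain ⟨k, hk1, hk2, hk3⟩ := ih (a + 1) b (by omega) hb (by omega) hc' h2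
        exact ⟨k, by omega, hk2, hk3⟩
  have hle : (α.toOrderHom l.castSucc).1 ≤ (α.toOrderHom l.succ).1 :=
    α.toOrderHom.monotone (Fin.castSucc_le_succ l)
  obtain ⟨k, hk1, hk2, hk3⟩ := key _ _ _ (α.toOrderHom l.castSucc).2 (α.toOrderHom l.succ).2
    (Nat.add_sub_of_le hle).symm h1 h2
  exact ⟨k, ⟨hk1, hk2⟩, hk3⟩

/-- The unique intermediate edge witnessing that `l` covers `j` along a composite. -/
noncomputable def Covers.mid {m n r : ℕ} {α : ⦋m⦌ ⟶ ⦋n⦌} {β : ⦋n⦌ ⟶ ⦋r⦌} {l : Fin m} {j : Fin r}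
    (h : Covers (α ≫ β) l j) : Fin n := h.exists_mid.choose

theorem Covers.mid_left {m n r : ℕ} {α : ⦋m⦌ ⟶ ⦋n⦌} {β : ⦋n⦌ ⟶ ⦋r⦌} {l : Fin m} {j : Fin r}
    (h : Covers (α ≫ β) l j) : Covers α l h.mid := h.exists_mid.choose_spec.1

theorem Covers.mid_right {m n r : ℕ} {α : ⦋m⦌ ⟶ ⦋n⦌} {β : ⦋n⦌ ⟶ ⦋r⦌} {l : Fin m} {j : Fin r}
    (h : Covers (α ≫ β) l j) : Covers β h.mid j := h.exists_mid.choose_spec.2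

/-- An `(a, b)`-shuffle: a pair of surjective simplicial operators `[a + b] → [a]` and
`[a + b] → [b]` with `left i + right i = i` for all `i`. -/
@[ext]
structure Shuffle (a b : ℕ) where
  left : ⦋a + b⦌ ⟶ ⦋a⦌
  right : ⦋a + b⦌ ⟶ ⦋b⦌
  left_surjective : Function.Surjective left.toOrderHom
  right_surjective : Function.Surjective right.toOrderHom
  add_eq : ∀ i : Fin (a + b + 1), (left.toOrderHom i).1 + (right.toOrderHom i).1 = i.1

/-! ### The 2-cell category `Θ₂` -/

/-- The objects `[n; q₁, …, qₙ]` of Joyal's 2-cell category (with the `q`'s numbered from `0`). -/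
structure Theta2 where
  n : ℕ
  q : Fin n → ℕ

namespace Theta2

/-- A cellular operator `[α; 𝛂] : [m; p] → [n; q]`: a simplicial operator `α : [m] → [n]`, together
with a simplicial operator `α_k : [p_l] → [q_k]` for each `k` covered by a (necessarily unique)
edge `l` of `[m]`. -/
@[ext]
structure Hom (X Y : Theta2) where
  base : ⦋X.n⦌ ⟶ ⦋Y.n⦌
  fib : ∀ (l : Fin X.n) (k : Fin Y.n), Covers base l k → (⦋X.q l⦌ ⟶ ⦋Y.q k⦌)

theorem Hom.ext' {X Y : Theta2} {f g : Hom X Y} (hb : f.base = g.base)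
    (hf : ∀ l k (h : Covers f.base l k) (h' : Covers g.base l k), f.fib l k h = g.fib l k h') :
    f = g := by
  obtain ⟨fb, ff⟩ := f
  obtain ⟨gb, gf⟩ := g
  obtain rfl : fb = gb := hb
  congr
  funext l k h
  exact hf l k h h

/-- The identity cellular operator. -/
def Hom.id (X : Theta2) : Hom X X where
  base := 𝟙 _
  fib _ _ h := eqToHom (congrArg (fun i => ⦋X.q i⦌) h.eq_of_id)

/-- The composite of two cellular operators: `(βα)_j = β_j α_k`, where `k` is the edge covering
`j`. -/
noncomputable def Hom.comp {X Y Z : Theta2} (f : Hom X Y) (g : Hom Y Z) : Hom X Z where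
  base := f.base ≫ g.base
  fib l j h := f.fib l h.mid h.mid_left ≫ g.fib h.mid j h.mid_right

theorem Hom.comp_fib {X Y Z : Theta2} (f : Hom X Y) (g : Hom Y Z) (l : Fin X.n) (k : Fin Y.n)
    (j : Fin Z.n) (h : Covers (f.base ≫ g.base) l j) (h₁ : Covers f.base l k)
    (h₂ : Covers g.base k j) : (f.comp g).fib l j h = f.fib l k h₁ ≫ g.fib k j h₂ := by
  obtain rfl : h.mid = k := h.mid_right.unique h₂
  rfl

noncomputable instance : Category Theta2 where
  Hom := Hom
  id := Hom.id
  comp f g := f.comp g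
  id_comp {X Y} f := by
    refine Hom.ext' (Category.id_comp _) fun l k h h' => ?_
    rw [Hom.comp_fib (Hom.id X) f l l k h (Covers.id l) h']
    simp [Hom.id]
  comp_id {X Y} f := by
    refine Hom.ext' (Category.comp_id _) fun l k h h' => ?_
    rw [Hom.comp_fib f (Hom.id Y) l k k h h' (Covers.id k)]
    simp [Hom.id]
  assoc {W X Y Z} f g e := by
    refine Hom.ext' (Category.assoc _ _ _) fun l k h h' => ?_
    have hb := h.mid_left
    have ha := h'.mid_left
    rw [Hom.comp_fib (f.comp g) e l _ k h h.mid_left h.mid_right,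
      Hom.comp_fib f g l _ _ hb hb.mid_left hb.mid_right,
      Hom.comp_fib f (g.comp e) l hb.mid k h' hb.mid_left (hb.mid_right.comp h.mid_right),
      Hom.comp_fib g e _ h.mid k _ hb.mid_right h.mid_right, Category.assoc]

theorem comp_base {X Y Z : Theta2} (f : X ⟶ Y) (g : Y ⟶ Z) :
    (f ≫ g).base = f.base ≫ g.base := rfl

theorem comp_fib {X Y Z : Theta2} (f : X ⟶ Y) (g : Y ⟶ Z) (l : Fin X.n) (k : Fin Y.n)
    (j : Fin Z.n) (h : Covers (f ≫ g).base l j) (h₁ : Covers f.base l k)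
    (h₂ : Covers g.base k j) : (f ≫ g).fib l j h = f.fib l k h₁ ≫ g.fib k j h₂ :=
  Hom.comp_fib f g l k j h h₁ h₂

/-- The dimension `n + q₁ + ⋯ + qₙ` of `[n; q]`. -/
def dim (X : Theta2) : ℕ := X.n + ∑ k, X.q k

/-- Face operators: `α` is monic and, for each edge `l`, the `α_k` with `k` covered by `l` are
jointly monic. -/
def IsFace {X Y : Theta2} (f : X ⟶ Y) : Prop :=
  Function.Injective f.base.toOrderHom ∧
    ∀ (l : Fin X.n) (a b : Fin (X.q l + 1)),
      (∀ (k : Fin Y.n) (h : Covers f.base l k),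
        (f.fib l k h).toOrderHom a = (f.fib l k h).toOrderHom b) → a = b

/-- A hyperface is a face operator of codimension `1`. -/
def IsHyperface {X Y : Theta2} (f : X ⟶ Y) : Prop :=
  IsFace f ∧ X.dim + 1 = Y.dim

/-- The domain `[n - 1; q₁, …, q_k + q_{k+1}, …, qₙ]` of the `k`-th horizontal hyperfaces of
`[n; q]`, where `n = N + 2` and `k = j + 1`. -/
def mergeObj {N : ℕ} (q : Fin (N + 2) → ℕ) (j : Fin (N + 1)) : Theta2 where
  n := N + 1
  q l := if l = j then q j.castSucc + q j.succ else if l < j then q l.castSucc else q l.succ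

theorem Covers_delta {N : ℕ} {j l : Fin (N + 1)} {i : Fin (N + 2)}
    (h : Covers (SimplexCategory.δ j.succ.castSucc) l i) :
    (i = j.castSucc → l = j) ∧ (i = j.succ → l = j) ∧
      (i ≠ j.castSucc → i ≠ j.succ → l ≠ j ∧ (l < j → i = l.castSucc) ∧ (¬ l < j → i = l.succ)) := by
  obtain ⟨h1, h2⟩ := h
  simp only [SimplexCategory.δ, SimplexCategory.mkHom, SimplexCategory.Hom.toOrderHom_mk,
    OrderEmbedding.toOrderHom_coe, Fin.succAboveOrderEmb_apply, Fin.succAbove, Fin.lt_def,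
    Fin.le_def, Fin.val_castSucc, Fin.val_succ] at h1 h2
  simp only [Fin.ext_iff, Fin.lt_def, Fin.val_castSucc, Fin.val_succ, ne_eq]
  split_ifs at h1 h2 <;> simp only [Fin.val_castSucc, Fin.val_succ] at h1 h2 <;> omega

theorem mergeObj_left {N : ℕ} (q : Fin (N + 2) → ℕ) {j l : Fin (N + 1)} {i : Fin (N + 2)}
    (h : Covers (SimplexCategory.δ j.succ.castSucc) l i) (hi : i = j.castSucc) :
    (mergeObj q j).q l = q j.castSucc + q j.succ := by
  simp [mergeObj, (Covers_delta h).1 hi]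

theorem mergeObj_right {N : ℕ} (q : Fin (N + 2) → ℕ) {j l : Fin (N + 1)} {i : Fin (N + 2)}
    (h : Covers (SimplexCategory.δ j.succ.castSucc) l i) (hi : i = j.succ) :
    (mergeObj q j).q l = q j.castSucc + q j.succ := by
  simp [mergeObj, (Covers_delta h).2.1 hi]

theorem mergeObj_other {N : ℕ} (q : Fin (N + 2) → ℕ) {j l : Fin (N + 1)} {i : Fin (N + 2)}
    (h : Covers (SimplexCategory.δ j.succ.castSucc) l i) (hi : i ≠ j.castSucc)
    (hi' : i ≠ j.succ) : (mergeObj q j).q l = q i := by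
  obtain ⟨h1, h2, h3⟩ := (Covers_delta h).2.2 hi hi'
  by_cases hl : l < j
  · simp [mergeObj, h1, hl, h2 hl]
  · simp [mergeObj, h1, hl, h3 hl]

/-- The `k`-th horizontal hyperface `[δᵏ; id, …, id, β, β', id, …, id]` of `[n; q]` indexed by a
`(q_k, q_{k+1})`-shuffle `⟨β, β'⟩`, for `1 ≤ k ≤ n - 1`; here `n = N + 2` and `k = j + 1`, so that
`q_k` and `q_{k+1}` are `q j.castSucc` and `q j.succ`. The maps `eqToHom` are identities. -/
def horizontalHyperface {N : ℕ} (q : Fin (N + 2) → ℕ) (j : Fin (N + 1))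
    (s : Shuffle (q j.castSucc) (q j.succ)) : mergeObj q j ⟶ (⟨N + 2, q⟩ : Theta2) where
  base := SimplexCategory.δ j.succ.castSucc
  fib _ i h :=
    if hi : i = j.castSucc then
      eqToHom (congrArg SimplexCategory.mk (mergeObj_left q h hi)) ≫ s.left ≫
        eqToHom (congrArg (fun t => ⦋q t⦌) hi.symm)
    else if hi' : i = j.succ then
      eqToHom (congrArg SimplexCategory.mk (mergeObj_right q h hi')) ≫ s.right ≫
        eqToHom (congrArg (fun t => ⦋q t⦌) hi'.symm)
    else eqToHom (congrArg SimplexCategory.mk (mergeObj_other q h hi hi'))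

end Theta2

/-- Cellular sets. -/
abbrev CellSet := Theta2ᵒᵖ ⥤ Type

/-! ### The box product -/

/-- The simplicial operator `[m] → [n]` over which an `m`-simplex of a simplicial set over `Δ[n]`
lies. -/
def overOp {n m : ℕ} (X : Over (Δ[n] : SSet.{0})) (x : X.left.obj (op ⦋m⦌)) : ⦋m⦌ ⟶ ⦋n⦌ :=
  SSet.stdSimplex.objEquiv (X.hom.app (op ⦋m⦌) x)

theorem overOp_map {n m m' : ℕ} (X : Over (Δ[n] : SSet.{0})) (f : ⦋m'⦌ ⟶ ⦋m⦌)
    (x : X.left.obj (op ⦋m⦌)) : overOp X (X.left.map f.op x) = f ≫ overOp X x := by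
  unfold overOp
  rw [NatTrans.naturality_apply]
  rfl

theorem overOp_app {n m : ℕ} {X Y : Over (Δ[n] : SSet.{0})} (f : X ⟶ Y)
    (x : X.left.obj (op ⦋m⦌)) : overOp Y (f.left.app _ x) = overOp X x := by
  unfold overOp
  rw [← Over.w f]
  rfl

/-- The cells of `□ₙ(X → Δ[n]; S₁, …, Sₙ)` of shape `[m; p]`: an `m`-simplex `x` of `X`, lying over
`α : [m] → [n]` say, together with a `p_l`-simplex of `S_k` for each `k` covered along `α` by the
edge `l` of `[m]`. This is the set of maps to `(X, χ)` from the image of `[m; p]` in the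
generalised wreath product, `χ` being the pullback to `X` of the object over `Δ[n]` that
corresponds to `(S₁, …, Sₙ)`: such a map amounts to `x : Δ[m] ⟶ X` together with, for each `l`, a
map from `Δ[p_l]` to the product of the `S_k` with `k` covered by `l`. -/
structure BoxCell {n : ℕ} (X : Over (Δ[n] : SSet.{0})) (S : Fin n → SSet.{0}) (c : Theta2) where
  x : X.left.obj (op ⦋c.n⦌)
  s : ∀ (l : Fin c.n) (k : Fin n), Covers (overOp X x) l k → (S k).obj (op ⦋c.q l⦌)

namespace BoxCell

theorem ext' {n : ℕ} {X : Over (Δ[n] : SSet.{0})} {S : Fin n → SSet.{0}} {c : Theta2}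
    {u v : BoxCell X S c} (hx : u.x = v.x) (hs : ∀ l k h h', u.s l k h = v.s l k h') : u = v := by
  obtain ⟨ux, us⟩ := u
  obtain ⟨vx, vs⟩ := v
  obtain rfl : ux = vx := hx
  congr
  funext l k h
  exact hs l k h h

/-- The action of cellular operators on the cells of a box product. -/
noncomputable def act {n : ℕ} {X : Over (Δ[n] : SSet.{0})} {S : Fin n → SSet.{0}} {c d : Theta2}
    (f : d ⟶ c) (u : BoxCell X S c) : BoxCell X S d where
  x := X.left.map f.base.op u.x
  s l k h :=
    have h' : Covers (f.base ≫ overOp X u.x) l k := overOp_map X f.base u.x ▸ h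
    (S k).map (f.fib l h'.mid h'.mid_left).op (u.s h'.mid k h'.mid_right)

theorem act_s {n : ℕ} {X : Over (Δ[n] : SSet.{0})} {S : Fin n → SSet.{0}} {c d : Theta2}
    (f : d ⟶ c) (u : BoxCell X S c) (l : Fin d.n) (i : Fin c.n) (k : Fin n)
    (h : Covers (overOp X (act f u).x) l k) (h₁ : Covers f.base l i)
    (h₂ : Covers (overOp X u.x) i k) :
    (act f u).s l k h = (S k).map (f.fib l i h₁).op (u.s i k h₂) := by
  have h' : Covers (f.base ≫ overOp X u.x) l k := overOp_map X f.base u.x ▸ h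
  obtain rfl : h'.mid = i := h'.mid_right.unique h₂
  rfl

theorem act_id {n : ℕ} {X : Over (Δ[n] : SSet.{0})} {S : Fin n → SSet.{0}} {c : Theta2}
    (u : BoxCell X S c) : act (𝟙 c) u = u := by
  refine ext' ?_ fun l k h h' => ?_
  · change X.left.map (𝟙 _) u.x = u.x
    simp
  · rw [act_s (𝟙 c) u l l k h (Covers.id l) h']
    change (S k).map (𝟙 _) _ = _
    simp

theorem act_comp {n : ℕ} {X : Over (Δ[n] : SSet.{0})} {S : Fin n → SSet.{0}} {c d e : Theta2}
    (f : d ⟶ c) (g : e ⟶ d) (u : BoxCell X S c) : act (g ≫ f) u = act g (act f u) := by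
  refine ext' ?_ fun l k h h' => ?_
  · change X.left.map (f.base.op ≫ g.base.op) u.x = X.left.map g.base.op (X.left.map f.base.op u.x)
    simp
  · have h₁ : Covers (g.base ≫ overOp X (act f u).x) l k := overOp_map X g.base _ ▸ h'
    have h₂ : Covers (f.base ≫ overOp X u.x) h₁.mid k := overOp_map X f.base _ ▸ h₁.mid_right
    have h₃ : Covers (g ≫ f).base l h₂.mid := h₁.mid_left.comp h₂.mid_left
    rw [act_s g (act f u) l _ k h' h₁.mid_left h₁.mid_right,
      act_s f u _ _ k h₁.mid_right h₂.mid_left h₂.mid_right,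
      act_s (g ≫ f) u l h₂.mid k h h₃ h₂.mid_right,
      Theta2.comp_fib g f l h₁.mid h₂.mid _ h₁.mid_left h₂.mid_left]
    simp

/-- The functoriality of the cells of a box product in `X` and `S₁, …, Sₙ`. -/
def map {n : ℕ} {X Y : Over (Δ[n] : SSet.{0})} {S T : Fin n → SSet.{0}} (f : X ⟶ Y)
    (g : ∀ k, S k ⟶ T k) {c : Theta2} (u : BoxCell X S c) : BoxCell Y T c where
  x := f.left.app _ u.x
  s l k h := (g k).app _ (u.s l k (overOp_app f u.x ▸ h))

theorem map_act {n : ℕ} {X Y : Over (Δ[n] : SSet.{0})} {S T : Fin n → SSet.{0}} (f : X ⟶ Y)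
    (g : ∀ k, S k ⟶ T k) {c d : Theta2} (e : d ⟶ c) (u : BoxCell X S c) :
    map f g (act e u) = act e (map f g u) := by
  refine ext' ?_ fun l k h h' => ?_
  · exact NatTrans.naturality_apply f.left e.base.op u.x
  · have h₀ : Covers (overOp X (act e u).x) l k := by
      rw [← overOp_app f]
      exact h
    have h₁ : Covers (e.base ≫ overOp X u.x) l k := overOp_map X e.base u.x ▸ h₀
    have h₂ : Covers (overOp Y (map f g u).x) h₁.mid k := by
      change Covers (overOp Y (f.left.app _ u.x)) _ _
      rw [overOp_app f]
      exact h₁.mid_right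
    rw [act_s e (map f g u) l h₁.mid k h' h₁.mid_left h₂]
    change (g k).app _ ((act e u).s l k h₀) = _
    rw [act_s e u l h₁.mid k h₀ h₁.mid_left h₁.mid_right]
    exact NatTrans.naturality_apply (g k) _ _

end BoxCell

/-- The functor `□ₙ`, from the product of `SSet / Δ[n]` and `n` copies of `SSet` to cellular
sets. -/
noncomputable def box (n : ℕ) : Over (Δ[n] : SSet.{0}) × (Fin n → SSet.{0}) ⥤ CellSet where
  obj P :=
    { obj := fun c => BoxCell P.1 P.2 c.unop
      map := fun f => ↾fun u => BoxCell.act f.unop u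
      map_id := fun c => by
        ext u
        exact BoxCell.act_id u
      map_comp := fun f g => by
        ext u
        exact BoxCell.act_comp f.unop g.unop u }
  map φ :=
    { app := fun c => ↾fun u => BoxCell.map φ.1 φ.2 u
      naturality := fun c d f => by
        ext u
        exact BoxCell.map_act φ.1 φ.2 f.unop u }
  map_id P := by
    ext c u
    exact BoxCell.ext' rfl fun l k h h' => rfl
  map_comp φ ψ := by
    ext c u
    exact BoxCell.ext' rfl fun l k h h' => rfl

/-! ### The Leibniz construction -/

section Leibniz

universe v₁ v₂ v₃ u₁ u₂ u₃

/-- The terminal object of the cube `2 × 2ⁿ`. -/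
def cubeTop (n : ℕ) : Fin 2 × (Fin n → Fin 2) := (1, fun _ => 1)

/-- The unique map from a vertex of the cube to the terminal one. -/
def toCubeTop {n : ℕ} (e : Fin 2 × (Fin n → Fin 2)) : e ⟶ cubeTop n :=
  (homOfLE (Fin.le_last e.1), fun k => homOfLE (Fin.le_last (e.2 k)))

/-- The full subcategory of the cube `2 × 2ⁿ` spanned by the non-terminal objects. -/
abbrev PuncturedCube (n : ℕ) :=
  ObjectProperty.FullSubcategory (fun e : Fin 2 × (Fin n → Fin 2) => e ≠ cubeTop n)

/-- The cube `2 × 2ⁿ → C × Dⁿ` given by arrows `f₀` in `C` and `f₁, …, fₙ` in `D`. -/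
def arrowCube {C : Type u₁} [Category.{v₁} C] {D : Type u₂} [Category.{v₂} D] {n : ℕ}
    (f₀ : Arrow C) (f : Fin n → Arrow D) : Fin 2 × (Fin n → Fin 2) ⥤ C × (Fin n → D) :=
  (ComposableArrows.mk₁ f₀.hom).prod (Functor.pi fun k => ComposableArrows.mk₁ (f k).hom)

/-- The value of the `(n + 1)`-ary Leibniz construction of `F : C × Dⁿ → E` at arrows `f₀` in `C`
and `f₁, …, fₙ` in `D`: the map to the value of `F` at the codomains of the arrows, from the
colimit over the non-terminal vertices of the cube. -/
noncomputable def leibniz {C : Type u₁} [Category.{v₁} C] {D : Type u₂} [Category.{v₂} D]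
    {E : Type u₃} [Category.{v₃} E] {n : ℕ} [HasColimitsOfShape (PuncturedCube n) E]
    (F : C × (Fin n → D) ⥤ E) (f₀ : Arrow C) (f : Fin n → Arrow D) :
    colimit (ObjectProperty.ι (fun e => e ≠ cubeTop n) ⋙ arrowCube f₀ f ⋙ F) ⟶
      F.obj ((arrowCube f₀ f).obj (cubeTop n)) :=
  colimit.desc (ObjectProperty.ι (fun e => e ≠ cubeTop n) ⋙ arrowCube f₀ f ⋙ F)
    { pt := F.obj ((arrowCube f₀ f).obj (cubeTop n))
      ι :=
        { app := fun e => (arrowCube f₀ f ⋙ F).map (toCubeTop e.obj)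
          naturality := fun e e' g => by
            dsimp only [Functor.const_obj_map, Functor.const_obj_obj]
            rw [Category.comp_id]
            exact ((arrowCube f₀ f ⋙ F).map_comp _ _).symm } }

end Leibniz

/-! ### Horn inclusions -/

/-- The inclusion of a subcomplex of `Δ[n]`, as a map over `Δ[n]`. -/
def overArrow {n : ℕ} (A : (Δ[n] : SSet.{0}).Subcomplex) : Arrow (Over (Δ[n] : SSet.{0})) :=
  Arrow.mk (Over.homMk A.ι : Over.mk A.ι ⟶ Over.mk (𝟙 (Δ[n] : SSet.{0})))

/-- The inclusion `∂Δ[n] → Δ[n]`. -/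
def boundaryArrow (n : ℕ) : Arrow SSet.{0} := Arrow.mk (SSet.boundary.{0} n).ι

/-- The set `H_h` of (Oury's) inner horizontal horn inclusions, obtained by applying the Leibniz
construction of `□ₙ` to `Λᵏ[n] → Δ[n]` (over `Δ[n]`) and `∂Δ[q_i] → Δ[q_i]` for `1 ≤ i ≤ n`, where
`1 ≤ k ≤ n - 1`. -/
inductive innerHorizontalHorns : ∀ ⦃X Y : CellSet⦄, (X ⟶ Y) → Prop where
  | mk (n : ℕ) (q : Fin n → ℕ) (k : Fin (n + 1)) (h₀ : 0 < k) (h₁ : k < Fin.last n) :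
    innerHorizontalHorns
      (leibniz (box n) (overArrow (SSet.horn n k)) (fun i => boundaryArrow (q i)))

/-- The set `H_v` of inner vertical horn inclusions, obtained by applying the Leibniz construction
of `□ₙ` to `∂Δ[n] → Δ[n]` (over `Δ[n]`), `Λⁱ[q_k] → Δ[q_k]` for some `1 ≤ k ≤ n` and
`1 ≤ i ≤ q_k - 1`, and `∂Δ[q_j] → Δ[q_j]` for `j ≠ k`. -/
inductive innerVerticalHorns : ∀ ⦃X Y : CellSet⦄, (X ⟶ Y) → Prop where
  | mk (n : ℕ) (q : Fin n → ℕ) (k : Fin n) (i : Fin (q k + 1)) (h₀ : 0 < i)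
    (h₁ : i < Fin.last (q k)) :
    innerVerticalHorns
      (leibniz (box n) (overArrow (SSet.boundary n))
        (Function.update (fun j => boundaryArrow (q j)) k (Arrow.mk (SSet.horn.{0} (q k) i).ι)))

/-- For a set `S` of hyperfaces of `X`, the cellular subset `Λ^S` of the representable `Θ₂[X]`
generated by all hyperfaces of `X` that are not in `S`. -/
noncomputable def generatedHorn (X : Theta2) (S : Set (Σ Y : Theta2, Y ⟶ X)) : Subfunctor (yoneda.obj X) :=
  ⨆ (d : Σ Y : Theta2, Y ⟶ X) (_ : Theta2.IsHyperface d.2 ∧ d ∉ S),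
    Subfunctor.range (yoneda.map d.2)

/-- The set `H'_h` of alternative inner horizontal horn inclusions: the inclusions into `Θ₂[n; q]`
of the cellular subset generated by all hyperfaces except for the `k`-th horizontal one indexed by
`s`, for `1 ≤ k ≤ n - 1` and a `(q_k, q_{k+1})`-shuffle `s`. Here `n = N + 2` and `k = j + 1`. -/
inductive alternativeHorizontalHorns : ∀ ⦃X Y : CellSet⦄, (X ⟶ Y) → Prop where
  | mk (N : ℕ) (q : Fin (N + 2) → ℕ) (j : Fin (N + 1)) (s : Shuffle (q j.castSucc) (q j.succ)) :
    alternativeHorizontalHorns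
      (generatedHorn ⟨N + 2, q⟩ {⟨_, Theta2.horizontalHyperface q j s⟩}).ι

/-- `cell(W)`: the closure of a class `W` of maps of cellular sets under transfinite composition
and pushouts along arbitrary maps, i.e. the smallest class containing `W` and closed under these
operations. -/
def cellClosure (W : MorphismProperty CellSet) : MorphismProperty CellSet :=
  sInf {P | W ≤ P ∧ P.IsStableUnderCobaseChange ∧
    MorphismProperty.IsStableUnderTransfiniteComposition.{0} P}

/-! The horizontal horn is filled by attaching the hyperfaces it lacks. Every Leibniz map in play is
the inclusion of a concrete subfunctor `boxHorn` of a representable (`leibniz_boxHorn_iff`), so the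
problem becomes one about unions of faces. The horn at an inner vertex `k` contains all hyperfaces
except the `k`-th horizontal ones. These are indexed by shuffles, that is, by lattice paths from
`(0, 0)` to `(q_k, q_{k+1})`, and they contain every cell whose base misses `k`
(`exists_mem_range_horizontalHyperface`).

Order the shuffles by their first coordinates and attach their hyperfaces one at a time, smaller
paths before larger ones, leaving out the last. What has been reached is then an alternative horn
(`shuffleHorn_compl_singleton`), so the remaining inclusion is in `H'_h`.

Attaching the hyperface of `s` is a pushout of the inclusion of its intersection with what is
already present. Inside the merged cell `[n - 1; …, q_k + q_{k+1}, …]`, that intersection is a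
vertical horn: the missing faces are those opposite to the corners of `s`, where the path turns from
the second direction to the first (`shuffleHorn_preimage`, resting on `Shuffle.omits_iff`). Corners
are inner vertices, and there is at least one as long as `s` is not the greatest shuffle. A vertical
horn lacking several inner faces is handled by attaching these faces in turn, each along a smaller
horn of the same kind (`boxHorn_ι_mem_of_innerVerticalHorns`). -/

/-! ### Gluing subfunctors -/

section Gluing

universe w v u

variable {C : Type u} [Category.{v} C]

/-- If `B` is the union of `A` and the image of a monomorphism `f`, then `B` is obtained from `A`
by a pushout along the inclusion of the preimage of `A`. -/
theorem CategoryTheory.Subfunctor.isPushout_preimage {F G : C ⥤ Type w} (A B : Subfunctor F)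
    (f : G ⟶ F) [Mono f] (hAB : A ≤ B) (hf : Subfunctor.range f ≤ B)
    (hB : B ≤ A ⊔ Subfunctor.range f) :
    IsPushout (A.fromPreimage f) (A.preimage f).ι (Subfunctor.homOfLe hAB)
      (Subfunctor.lift f hf) := by
  refine IsPushout.of_forall_isPushout_app fun U => ?_
  have hinj : Function.Injective (f.app U) := by
    have := (NatTrans.mono_iff_mono_app f).1 inferInstance U
    exact (mono_iff_injective _).1 this
  refine Types.isPushout_of_isPullback_of_mono' ?_ ?_ ?_
  · rw [Types.isPullback_iff]
    refine ⟨rfl, ?_, ?_⟩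
    · rintro x y ⟨-, h⟩
      exact Subtype.ext h
    · rintro ⟨a, ha⟩ b h
      have h' : a = f.app U b := congrArg Subtype.val h
      exact ⟨⟨b, by change f.app U b ∈ A.obj U; rwa [← h']⟩, Subtype.ext h'.symm, rfl⟩
  · rw [Set.eq_univ_iff_forall]
    rintro ⟨x, hx⟩
    rcases hB U hx with h | ⟨y, hy⟩
    · exact Or.inl ⟨⟨x, h⟩, rfl⟩
    · exact Or.inr ⟨y, Subtype.ext hy⟩
  · intro x y _ _ h
    exact hinj (congrArg Subtype.val h)

/-- The attaching step, read backwards: `A.ι` factors through `B`, and `A → B` is a pushout of the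
inclusion of the preimage of `A`. Only binary composites are needed, since all the filtrations below
are finite. -/
theorem CategoryTheory.MorphismProperty.subfunctor_ι_of_glue {F G : C ⥤ Type w}
    (P : MorphismProperty (C ⥤ Type w)) [P.IsStableUnderCobaseChange]
    [P.IsStableUnderComposition] {A B : Subfunctor F} (f : G ⟶ F) [Mono f]
    (hB : B = A ⊔ Subfunctor.range f) (hA : P (A.preimage f).ι) (hB' : P B.ι) : P A.ι := by
  have hAB : A ≤ B := hB ▸ le_sup_left
  have sq := A.isPushout_preimage B f hAB (hB ▸ le_sup_right) hB.le
  rw [← Subfunctor.homOfLe_ι hAB]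
  exact P.comp_mem _ _ (P.of_isPushout sq hA) hB'

/-- A monomorphism is isomorphic, as an arrow, to the inclusion of its image. This passes from
abstract Leibniz maps to subfunctors of representables. -/
theorem CategoryTheory.MorphismProperty.iff_subfunctor_ι {F G H : C ⥤ Type w}
    (P : MorphismProperty (C ⥤ Type w)) [P.RespectsIso] (φ : G ⟶ H) (hφ : Mono φ) (e : H ≅ F)
    (A : Subfunctor F) (hA : Subfunctor.range (φ ≫ e.hom) = A) : P φ ↔ P A.ι := by
  subst hA
  let i : CategoryTheory.Arrow.mk φ ≅ CategoryTheory.Arrow.mk (Subfunctor.range (φ ≫ e.hom)).ι :=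
    CategoryTheory.Arrow.isoMk (asIso (Subfunctor.toRange (φ ≫ e.hom))) e rfl
  exact P.arrow_mk_iso_iff i

end Gluing

/-! ### Horns of the boxes -/

/-- The subcomplex of `Δ[n]` generated by the codimension one faces opposite to the vertices not
in `K`. -/
noncomputable def SSet.genHorn (n : ℕ) (K : Set (Fin (n + 1))) : (Δ[n] : SSet.{0}).Subcomplex where
  obj _ := {s | ∃ j, j ∉ K ∧ j ∉ Set.range (SSet.stdSimplex.objEquiv s).toOrderHom}
  map φ s := by
    rintro ⟨j, hj, h⟩
    exact ⟨j, hj, fun ⟨i, hi⟩ => h ⟨_, hi⟩⟩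

theorem SSet.horn_eq_genHorn {n : ℕ} (k : Fin (n + 1)) :
    SSet.horn.{0} n k = SSet.genHorn n {k} := by
  ext ⟨⟨d⟩⟩ s
  exact (SSet.mem_horn_iff_notMem_range (d := d) s k).trans
    ⟨fun ⟨j, h, h'⟩ => ⟨j, h, h'⟩, fun ⟨j, h, h'⟩ => ⟨j, h, h'⟩⟩

theorem SSet.boundary_eq_genHorn (n : ℕ) : SSet.boundary.{0} n = SSet.genHorn n ∅ := by
  ext ⟨⟨d⟩⟩ s
  exact (SSet.mem_boundary_iff_notMem_range (d := d) s).trans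
    ⟨fun ⟨j, h⟩ => ⟨j, id, h⟩, fun ⟨j, _, h⟩ => ⟨j, h⟩⟩

/-- The cellular subset of `Θ₂[n; q]` of those cells `[α; 𝛂]` such that `α` misses a vertex not in
`K` or, for some `k`, all the `α_k` miss a vertex not in `R k`. -/
noncomputable def boxHorn {n : ℕ} (q : Fin n → ℕ) (K : Set (Fin (n + 1))) (R : ∀ k, Set (Fin (q k + 1))) :
    Subfunctor (yoneda.obj (⟨n, q⟩ : Theta2)) where
  obj U := Set.ofPred fun c : unop U ⟶ (⟨n, q⟩ : Theta2) =>
    (∃ x, x ∉ K ∧ x ∉ Set.range c.base.toOrderHom) ∨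
    -- At most one `l` covers `k`. If none does, the condition holds vacuously: the cell then
    -- involves no simplex in the `k`-th variable.
    ∃ k, ∀ l h, ∃ x, x ∉ R k ∧ x ∉ Set.range (c.fib l k h).toOrderHom
  map {U V} φ c hc := by
    rcases hc with ⟨x, hx, hx'⟩ | ⟨k, hk⟩
    · exact Or.inl ⟨x, hx, fun ⟨i, hi⟩ => hx' ⟨_, hi⟩⟩
    · refine Or.inr ⟨k, fun l h => ?_⟩
      have h' : Covers (φ.unop.base ≫ c.base) l k := h
      obtain ⟨x, hx, hx'⟩ := hk h'.mid h'.mid_right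
      exact ⟨x, hx, fun ⟨i, hi⟩ => hx' ⟨_, hi⟩⟩

theorem mem_boxHorn {n : ℕ} {q : Fin n → ℕ} {K : Set (Fin (n + 1))}
    {R : ∀ k, Set (Fin (q k + 1))} {Y : Theta2} (c : Y ⟶ (⟨n, q⟩ : Theta2)) :
    c ∈ (boxHorn q K R).obj (op Y) ↔
    (∃ x, x ∉ K ∧ x ∉ Set.range c.base.toOrderHom) ∨
    ∃ k, ∀ l h, ∃ x, x ∉ R k ∧ x ∉ Set.range (c.fib l k h).toOrderHom := Iff.rfl

namespace BoxCell

theorem map_injective {n : ℕ} {X Y : Over (Δ[n] : SSet.{0})} {S T : Fin n → SSet.{0}} (f : X ⟶ Y)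
    (g : ∀ k, S k ⟶ T k) {c : Theta2} (hf : Function.Injective (f.left.app (op ⦋c.n⦌)))
    (hg : ∀ k l, Function.Injective ((g k).app (op ⦋c.q l⦌))) :
    Function.Injective (BoxCell.map f g (c := c)) := by
  rintro ⟨x, s⟩ ⟨y, t⟩ h
  obtain rfl : x = y := hf (congrArg BoxCell.x h)
  refine ext' rfl fun l k h₁ _ => hg k l ?_
  have h₂ := eq_of_heq (BoxCell.mk.inj h).2
  exact congrFun (congrFun (congrFun h₂ l) k) ((overOp_app f x).symm ▸ h₁)

end BoxCell

/-- The box product of standard simplices is representable. -/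
noncomputable def boxStdSimplexIso {n : ℕ} (q : Fin n → ℕ) :
    (box n).obj (Over.mk (𝟙 (Δ[n] : SSet.{0})), fun k => Δ[q k]) ≅
      yoneda.obj (⟨n, q⟩ : Theta2) :=
  NatIso.ofComponents (fun U => Equiv.toIso
    { toFun := fun u =>
        (⟨overOp _ u.x, fun l k h => SSet.stdSimplex.objEquiv (u.s l k h)⟩ :
          Theta2.Hom (unop U) ⟨n, q⟩)
      invFun := fun (c : Theta2.Hom (unop U) ⟨n, q⟩) =>
        ⟨SSet.stdSimplex.objEquiv.symm c.base,
          fun l k h => SSet.stdSimplex.objEquiv.symm (c.fib l k h)⟩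
      left_inv := fun u => rfl
      right_inv := fun c => rfl }) (by
    intro U V f
    ext u
    refine Theta2.Hom.ext' rfl fun l k h h' => ?_
    rfl)


/-! ### The Leibniz construction and unions -/

section Leibniz

universe v₁ v₂ v₃ w u₁ u₂ u₃

variable {C : Type u₁} [Category.{v₁} C] {D : Type u₂} [Category.{v₂} D]
  {E : Type u₃} [Category.{v₃} E] {n : ℕ}

/-- The map between two comparable vertices of the cube. -/
def cubeHom {e e' : Fin 2 × (Fin n → Fin 2)} (h : e ≤ e') : e ⟶ e' :=
  (homOfLE h.1, fun k => homOfLE (h.2 k))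

theorem cubeHom_comp_toCubeTop {e e' : Fin 2 × (Fin n → Fin 2)} (h : e ≤ e') :
    cubeHom h ≫ toCubeTop e' = toCubeTop e := rfl

theorem meet_ne_cubeTop {e e' : Fin 2 × (Fin n → Fin 2)} (h : e ≠ cubeTop n) :
    e ⊓ e' ≠ cubeTop n := fun h' =>
  h (le_antisymm (Prod.mk_le_mk.2 ⟨Fin.le_last _, fun _ => Fin.le_last _⟩) (h' ▸ inf_le_left))

theorem leibniz_exists_rep (F : C × (Fin n → D) ⥤ E ⥤ Type w) (f₀ : Arrow C) (f : Fin n → Arrow D)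
    (U : E) (x : (colimit (ObjectProperty.ι (fun e => e ≠ cubeTop n) ⋙ arrowCube f₀ f ⋙ F)).obj U) :
    ∃ (e : PuncturedCube n) (u : (F.obj ((arrowCube f₀ f).obj e.obj)).obj U),
      (colimit.ι (ObjectProperty.ι (fun e => e ≠ cubeTop n) ⋙ arrowCube f₀ f ⋙ F) e).app U u = x :=
  Types.jointly_surjective_of_isColimit
    (isColimitOfPreserves ((evaluation E (Type w)).obj U) (colimit.isColimit
      (ObjectProperty.ι (fun e => e ≠ cubeTop n) ⋙ arrowCube f₀ f ⋙ F))) x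

theorem leibniz_app_ι (F : C × (Fin n → D) ⥤ E ⥤ Type w) (f₀ : Arrow C) (f : Fin n → Arrow D)
    (U : E) (e : PuncturedCube n) (u : (F.obj ((arrowCube f₀ f).obj e.obj)).obj U) :
    (leibniz F f₀ f).app U ((colimit.ι
      (ObjectProperty.ι (fun e => e ≠ cubeTop n) ⋙ arrowCube f₀ f ⋙ F) e).app U u) =
      ((arrowCube f₀ f ⋙ F).map (toCubeTop e.obj)).app U u := by
  have h : colimit.ι (ObjectProperty.ι (fun e => e ≠ cubeTop n) ⋙ arrowCube f₀ f ⋙ F) e ≫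
      leibniz F f₀ f = (arrowCube f₀ f ⋙ F).map (toCubeTop e.obj) := colimit.ι_desc _ _
  rw [← h]
  rfl

/-- If all the maps of the cube are injective and its squares are cartesian, the Leibniz
construction yields a monomorphism. -/
theorem leibniz_mono (F : C × (Fin n → D) ⥤ E ⥤ Type w) (f₀ : Arrow C) (f : Fin n → Arrow D)
    (hinj : ∀ (e : Fin 2 × (Fin n → Fin 2)) (U : E),
      Function.Injective (((arrowCube f₀ f ⋙ F).map (toCubeTop e)).app U))
    (hmeet : ∀ (e e' : Fin 2 × (Fin n → Fin 2)) (U : E) (u : ((arrowCube f₀ f ⋙ F).obj e).obj U)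
      (u' : ((arrowCube f₀ f ⋙ F).obj e').obj U),
      ((arrowCube f₀ f ⋙ F).map (toCubeTop e)).app U u =
        ((arrowCube f₀ f ⋙ F).map (toCubeTop e')).app U u' →
      ∃ v : ((arrowCube f₀ f ⋙ F).obj (e ⊓ e')).obj U,
        ((arrowCube f₀ f ⋙ F).map (toCubeTop (e ⊓ e'))).app U v =
          ((arrowCube f₀ f ⋙ F).map (toCubeTop e)).app U u) :
    Mono (leibniz F f₀ f) := by
  rw [NatTrans.mono_iff_mono_app]
  intro U
  rw [mono_iff_injective]
  intro x x' h
  obtain ⟨e, u, rfl⟩ := leibniz_exists_rep F f₀ f U x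
  obtain ⟨e', u', rfl⟩ := leibniz_exists_rep F f₀ f U x'
  rw [leibniz_app_ι, leibniz_app_ι] at h
  obtain ⟨v, hv⟩ := hmeet _ _ _ _ _ h
  -- Both representatives come from `v` at the meet of their vertices. Injectivity of the map to the
  -- top vertex shows that `u₁` is the image of `v`, so the colimit identifies them.
  have key : ∀ (e₁ : PuncturedCube n) (hle : e.obj ⊓ e'.obj ≤ e₁.obj)
      (u₁ : ((arrowCube f₀ f ⋙ F).obj e₁.obj).obj U),
      ((arrowCube f₀ f ⋙ F).map (toCubeTop (e.obj ⊓ e'.obj))).app U v =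
        ((arrowCube f₀ f ⋙ F).map (toCubeTop e₁.obj)).app U u₁ →
      (colimit.ι (ObjectProperty.ι (fun e => e ≠ cubeTop n) ⋙ arrowCube f₀ f ⋙ F) e₁).app U u₁ =
      (colimit.ι (ObjectProperty.ι (fun e => e ≠ cubeTop n) ⋙ arrowCube f₀ f ⋙ F)
        ⟨e.obj ⊓ e'.obj, meet_ne_cubeTop e.property⟩).app U v := by
    intro e₁ hle u₁ hu
    have h₁ : u₁ = ((arrowCube f₀ f ⋙ F).map (cubeHom hle)).app U v := by
      apply hinj e₁.obj U
      rw [← hu, ← cubeHom_comp_toCubeTop hle, Functor.map_comp]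
      rfl
    rw [h₁, ← colimit.w (ObjectProperty.ι (fun e => e ≠ cubeTop n) ⋙ arrowCube f₀ f ⋙ F)
      (show (⟨e.obj ⊓ e'.obj, meet_ne_cubeTop e.property⟩ : PuncturedCube n) ⟶ e₁ from
        ObjectProperty.homMk (cubeHom hle))]
    rfl
  rw [key e inf_le_left u hv, key e' inf_le_right u' (hv.trans h)]

end Leibniz

/-! ### The Leibniz maps of the box product as subobjects of a representable -/

section
variable {n : ℕ} (q : Fin n → ℕ) (K : Set (Fin (n + 1))) (R : ∀ k, Set (Fin (q k + 1)))

/-- The arrow `SSet.genHorn n K → Δ[n]`. -/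
noncomputable abbrev genHornArrow (n : ℕ) (K : Set (Fin (n + 1))) : Arrow SSet.{0} :=
  Arrow.mk (SSet.genHorn n K).ι

theorem mk₁_left_app_injective (a : Fin 2) (f : a ⟶ 1) (U) : Function.Injective
    (((ComposableArrows.mk₁ (overArrow (SSet.genHorn n K)).hom).map f).left.app U) := by
  fin_cases a
  · exact Subtype.val_injective
  · intro x y h
    exact h

theorem mk₁_app_injective (a : Fin 2) (f : a ⟶ 1) (U) : Function.Injective
    (((ComposableArrows.mk₁ (genHornArrow n K).hom).map f).app U) := by
  fin_cases a
  · exact Subtype.val_injective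
  · intro x y h
    exact h

theorem mk₁_left_app_range (a : Fin 2) (f : a ⟶ 1) (U) (y) :
    y ∈ Set.range (((ComposableArrows.mk₁ (overArrow (SSet.genHorn n K)).hom).map f).left.app U) ↔
     (a = 0 → y ∈ (SSet.genHorn n K).obj U) := by
  fin_cases a
  · exact ⟨fun ⟨x, hx⟩ _ => hx ▸ x.2, fun h => ⟨⟨y, h rfl⟩, rfl⟩⟩
  · exact ⟨fun _ h => absurd h (by decide), fun h => ⟨y, rfl⟩⟩

theorem mk₁_app_range (a : Fin 2) (f : a ⟶ 1) (U) (y) :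
    y ∈ Set.range (((ComposableArrows.mk₁ (genHornArrow n K).hom).map f).app U) ↔
     (a = 0 → y ∈ (SSet.genHorn n K).obj U) := by
  fin_cases a
  · exact ⟨fun ⟨x, hx⟩ _ => hx ▸ x.2, fun h => ⟨⟨y, h rfl⟩, rfl⟩⟩
  · exact ⟨fun _ h => absurd h (by decide), fun h => ⟨y, rfl⟩⟩


/-- The cube whose Leibniz construction is the inclusion of `boxHorn q K R`. -/
noncomputable abbrev boxHornCube : Fin 2 × (Fin n → Fin 2) ⥤ CellSet :=
  arrowCube (overArrow (SSet.genHorn n K)) (fun k => genHornArrow (q k) (R k)) ⋙ box n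

theorem boxHornCube_injective (e : Fin 2 × (Fin n → Fin 2)) (U : Theta2ᵒᵖ) :
    Function.Injective (((boxHornCube q K R).map (toCubeTop e)).app U) :=
  BoxCell.map_injective _ _ (mk₁_left_app_injective K e.1 (toCubeTop e).1 _)
    fun k _ => mk₁_app_injective (R k) (e.2 k) ((toCubeTop e).2 k) _

/-- The zero coordinates of `e` impose independent conditions. Hence the image at `e ⊓ e'` is the
intersection of the images at `e` and `e'`, which is the cartesianness required by `leibniz_mono`.
-/
theorem boxHornCube_range (e : Fin 2 × (Fin n → Fin 2)) (U : Theta2ᵒᵖ)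
    (z : BoxCell (Over.mk (𝟙 (Δ[n] : SSet.{0}))) (fun k => Δ[q k]) (unop U)) :
    z ∈ Set.range (((boxHornCube q K R).map (toCubeTop e)).app U) ↔
      (e.1 = 0 → z.x ∈ (SSet.genHorn n K).obj _) ∧
      ∀ k, e.2 k = 0 → ∀ l h, z.s l k h ∈ (SSet.genHorn (q k) (R k)).obj _ := by
  constructor
  · rintro ⟨u, rfl⟩
    exact ⟨(mk₁_left_app_range K e.1 (toCubeTop e).1 _ _).1 ⟨u.x, rfl⟩,
      fun k hk l h => (mk₁_app_range (R k) (e.2 k) ((toCubeTop e).2 k) _ _).1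
        ⟨u.s l k (overOp_app ((ComposableArrows.mk₁ (overArrow (SSet.genHorn n K)).hom).map
          (toCubeTop e).1) u.x ▸ h), rfl⟩ hk⟩
  · rintro ⟨hx, hs⟩
    obtain ⟨x, hx⟩ := (mk₁_left_app_range K e.1 (toCubeTop e).1 _ _).2 hx
    have hs' : ∀ l k h, ∃ t, (((ComposableArrows.mk₁ (genHornArrow (q k) (R k)).hom).map
        ((toCubeTop e).2 k)).app (op ⦋(unop U).q l⦌)) t = z.s l k h :=
      fun l k h => (mk₁_app_range (R k) (e.2 k) ((toCubeTop e).2 k) _ _).2 fun hk => hs k hk l h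
    choose t ht using hs'
    obtain ⟨zx, zs⟩ := z
    dsimp only at hx
    subst hx
    refine ⟨⟨x, fun l k h => t l k ?_⟩, BoxCell.ext' rfl fun l k h h' => ht l k h'⟩
    exact (overOp_app ((ComposableArrows.mk₁ (overArrow (SSet.genHorn n K)).hom).map
          (toCubeTop e).1) x).symm ▸ h

theorem leibniz_boxHorn_mono :
    Mono (leibniz (box n) (overArrow (SSet.genHorn n K)) fun k => genHornArrow (q k) (R k)) := by
  refine leibniz_mono _ _ _ (boxHornCube_injective q K R) fun e e' U u u' h => ?_
  have h₁ := (boxHornCube_range q K R e U _).1 ⟨u, rfl⟩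
  have h₂ := (boxHornCube_range q K R e' U _).1 ⟨u', rfl⟩
  rw [← h] at h₂
  have aux : ∀ a b : Fin 2, a ⊓ b = 0 → a = 0 ∨ b = 0 := by decide
  refine (boxHornCube_range q K R (e ⊓ e') U _).2 ⟨fun h0 => ?_, fun k hk => ?_⟩
  · exact (aux _ _ h0).elim h₁.1 h₂.1
  · exact (aux _ _ hk).elim (h₁.2 k) (h₂.2 k)

theorem range_leibniz_boxHorn :
    Subfunctor.range (leibniz (box n) (overArrow (SSet.genHorn n K))
      (fun k => genHornArrow (q k) (R k)) ≫ (boxStdSimplexIso q).hom) = boxHorn q K R := by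
  ext U c
  constructor
  · rintro ⟨x, rfl⟩
    obtain ⟨e, u, rfl⟩ := leibniz_exists_rep _ _ _ U x
    have h₁ := (boxHornCube_range q K R e.obj U _).1 ⟨u, rfl⟩
    refine (congrArg (· ∈ (boxHorn q K R).obj U) (congrArg ((boxStdSimplexIso q).hom.app U)
      (leibniz_app_ι (box n) (overArrow (SSet.genHorn n K)) (fun k => genHornArrow (q k) (R k))
        U e u))).mpr ?_
    by_cases h0 : e.obj.1 = 0
    · exact Or.inl (h₁.1 h0)
    · by_cases hk : ∃ k, e.obj.2 k = 0
      · obtain ⟨k, hk⟩ := hk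
        exact Or.inr ⟨k, h₁.2 k hk⟩
      · refine absurd (Prod.ext (Fin.eq_one_of_ne_zero _ h0) ?_) e.property
        funext k
        exact Fin.eq_one_of_ne_zero _ fun h => hk ⟨k, h⟩
  · intro hc
    let z : BoxCell (Over.mk (𝟙 (Δ[n] : SSet.{0}))) (fun k => Δ[q k]) (unop U) :=
      (boxStdSimplexIso q).inv.app U c
    have hz : (boxStdSimplexIso q).hom.app U z = c := rfl
    have key : ∀ e : PuncturedCube n, z ∈ Set.range
        (((boxHornCube q K R).map (toCubeTop e.obj)).app U) →
        c ∈ (Subfunctor.range (leibniz (box n) (overArrow (SSet.genHorn n K))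
          (fun k => genHornArrow (q k) (R k)) ≫ (boxStdSimplexIso q).hom)).obj U := by
      rintro e ⟨u, hu⟩
      refine ⟨(colimit.ι (ObjectProperty.ι (fun e => e ≠ cubeTop n) ⋙ boxHornCube q K R) e).app U u,
        ?_⟩
      exact (congrArg ((boxStdSimplexIso q).hom.app U) ((leibniz_app_ι (box n)
        (overArrow (SSet.genHorn n K)) (fun k => genHornArrow (q k) (R k)) U e u).trans hu)).trans hz
    -- The maximal non-terminal vertices of the cube, those with exactly one coordinate `0`, already
    -- give the whole union.
    rcases hc with hc | ⟨k, hk⟩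
    · refine key ⟨(0, fun _ => 1), fun h => ?_⟩ ((boxHornCube_range q K R _ U _).2
        ⟨fun _ => hc, fun k hk => absurd hk one_ne_zero⟩)
      exact absurd (congrArg Prod.fst h) zero_ne_one
    · refine key ⟨(1, Function.update (fun _ => 1) k 0), fun h => ?_⟩
        ((boxHornCube_range q K R _ U _).2 ⟨fun h => absurd h one_ne_zero, fun k' hk' => ?_⟩)
      · have := congrFun (congrArg Prod.snd h) k
        simp [cubeTop] at this
      · obtain rfl : k' = k := by
          by_contra hne
          simp [Function.update_of_ne hne] at hk'
        exact hk

theorem leibniz_boxHorn_iff (P : MorphismProperty CellSet) [P.RespectsIso] :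
    P (leibniz (box n) (overArrow (SSet.genHorn n K)) fun k => genHornArrow (q k) (R k)) ↔
      P (boxHorn q K R).ι :=
  P.iff_subfunctor_ι _ (leibniz_boxHorn_mono q K R) (boxStdSimplexIso q) _ (range_leibniz_boxHorn q K R)

end

theorem innerHorizontalHorns_iff {n : ℕ} (q : Fin n → ℕ) (k : Fin (n + 1))
    (P : MorphismProperty CellSet) [P.RespectsIso] :
    P (leibniz (box n) (overArrow (SSet.horn n k)) (fun i => boundaryArrow (q i))) ↔
      P (boxHorn q {k} fun _ => ∅).ι := by
  rw [SSet.horn_eq_genHorn, show (fun i => boundaryArrow (q i)) = fun i => genHornArrow (q i) ∅ from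
    funext fun i => by rw [boundaryArrow, SSet.boundary_eq_genHorn]]
  exact leibniz_boxHorn_iff q {k} (fun _ => ∅) P

theorem innerVerticalHorns_iff {n : ℕ} (q : Fin n → ℕ) (k : Fin n) (i : Fin (q k + 1))
    (R : ∀ k, Set (Fin (q k + 1))) (hk : R k = {i}) (hR : ∀ l, l ≠ k → R l = ∅)
    (P : MorphismProperty CellSet) [P.RespectsIso] :
    P (leibniz (box n) (overArrow (SSet.boundary n))
        (Function.update (fun j => boundaryArrow (q j)) k (Arrow.mk (SSet.horn.{0} (q k) i).ι))) ↔
      P (boxHorn q ∅ R).ι := by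
  rw [SSet.boundary_eq_genHorn, show Function.update (fun j => boundaryArrow (q j)) k
    (Arrow.mk (SSet.horn.{0} (q k) i).ι) = fun i => genHornArrow (q i) (R i) from
    funext fun l => by
      by_cases hl : l = k
      · subst hl
        rw [Function.update_self, hk, SSet.horn_eq_genHorn]
      · rw [Function.update_of_ne hl, hR l hl, boundaryArrow, SSet.boundary_eq_genHorn]]
  exact leibniz_boxHorn_iff q ∅ R P

/-! ### Faces and factorizations -/

namespace SimplexCategory

theorem exists_mono_range {q : ℕ} (S : Set (Fin (q + 1))) (hS : S.Nonempty) :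
    ∃ (r : ℕ) (φ : ⦋r⦌ ⟶ ⦋q⦌), Function.Injective φ.toOrderHom ∧
      Set.range φ.toOrderHom = S := by
  classical
  have hc : S.toFinset.card = (S.toFinset.card - 1) + 1 :=
    (Nat.sub_add_cancel (Finset.card_pos.2 (by simpa using hS))).symm
  refine ⟨S.toFinset.card - 1, SimplexCategory.mkHom (S.toFinset.orderEmbOfFin hc).toOrderHom,
    (S.toFinset.orderEmbOfFin hc).injective, ?_⟩
  exact (Finset.range_orderEmbOfFin S.toFinset hc).trans (by simp)

theorem exists_lift_of_range_subset {p r q : ℕ} (u : ⦋p⦌ ⟶ ⦋q⦌) (φ : ⦋r⦌ ⟶ ⦋q⦌)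
    (hφ : Function.Injective φ.toOrderHom)
    (h : Set.range u.toOrderHom ⊆ Set.range φ.toOrderHom) : ∃ v : ⦋p⦌ ⟶ ⦋r⦌, v ≫ φ = u := by
  have h' : ∀ x, ∃ y, φ.toOrderHom y = u.toOrderHom x := fun x => h ⟨x, rfl⟩
  choose v hv using h'
  have hmono : StrictMono φ.toOrderHom := φ.toOrderHom.monotone.strictMono_of_injective hφ
  refine ⟨SimplexCategory.mkHom ⟨v, fun x y hxy => ?_⟩, ?_⟩
  · rw [← hmono.le_iff_le, hv, hv]
    exact u.toOrderHom.monotone hxy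
  · ext x : 3
    exact hv x

end SimplexCategory

/-- A discrete intermediate value argument: view `a ≤ b` as an operator from `[1]`; its edge covers
`k` along the composite with `α`, so some edge of `[m]` between `a` and `b` does. -/
theorem Covers.exists_of_mem_range {m n : ℕ} {α : ⦋m⦌ ⟶ ⦋n⦌} {k : Fin n} {a b : Fin (m + 1)}
    (ha : α.toOrderHom a ≤ k.castSucc) (hb : k.succ ≤ α.toOrderHom b) :
    ∃ l, Covers α l k := by
  have hab : a ≤ b := by
    by_contra h
    have := (α.toOrderHom.monotone (not_le.1 h).le)
    exact absurd (hb.trans (this.trans ha)) (by simp [Fin.le_def])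
  have h : Covers (SimplexCategory.mkHom (n := 1) ⟨![a, b], fun x y h => by
      fin_cases x <;> fin_cases y <;> simp_all⟩ ≫ α) 0 k := ⟨ha, hb⟩
  obtain ⟨l, -, hl⟩ := h.exists_mid
  exact ⟨l, hl⟩

theorem Covers.exists_of_surjective {m n : ℕ} {α : ⦋m⦌ ⟶ ⦋n⦌}
    (h : Function.Surjective α.toOrderHom) (k : Fin n) : ∃ l, Covers α l k := by
  obtain ⟨a, ha⟩ := h k.castSucc
  obtain ⟨b, hb⟩ := h k.succ
  exact Covers.exists_of_mem_range ha.le hb.ge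

namespace Theta2

/-- A single `v` must serve all the edges `k` covered by `l` simultaneously. For a horizontal
hyperface this is the condition that two coordinates lie on a common path. -/
theorem exists_factor {Y D X : Theta2} (g : D ⟶ X) (c : Y ⟶ X) (u : ⦋Y.n⦌ ⟶ ⦋D.n⦌)
    (hu : u ≫ g.base = c.base)
    (hf : ∀ i l, Covers u i l → ∃ v : ⦋Y.q i⦌ ⟶ ⦋D.q l⦌,
      ∀ k (h' : Covers g.base l k) (h'' : Covers c.base i k), v ≫ g.fib l k h' = c.fib i k h'') :
    ∃ c' : Y ⟶ D, c' ≫ g = c := by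
  choose v hv using hf
  refine ⟨⟨u, v⟩, Hom.ext' hu fun i k h h' => ?_⟩
  have h₁ : Covers (u ≫ g.base) i k := h
  rw [comp_fib (⟨u, v⟩ : Hom Y D) g i h₁.mid k h h₁.mid_left h₁.mid_right]
  exact hv _ _ _ _ _ _

theorem IsFace.mono {D X : Theta2} {g : D ⟶ X} (hg : IsFace g) : Mono g := by
  refine ⟨fun {Y} c c' h => Hom.ext' ?_ fun i l h₁ h₂ => ?_⟩
  · have hb : c.base ≫ g.base = c'.base ≫ g.base := congrArg Hom.base h
    ext x : 3
    exact hg.1 (congrArg (fun (t : ⦋Y.n⦌ ⟶ ⦋X.n⦌) => t.toOrderHom x) hb)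
  · ext a : 3
    refine hg.2 l _ _ fun k hk => ?_
    -- The type of `fib` depends on a covering proof for the base, so the equality of composites is
    -- transported by substitution.
    have key : ∀ (d d' : Y ⟶ X) (e : d = d') (h : Covers d.base i k) (h' : Covers d'.base i k),
        d.fib i k h = d'.fib i k h' := by
      rintro d _ rfl h h'
      rfl
    have := (comp_fib c g i l k (h₁.comp hk) h₁ hk).symm.trans
      ((key _ _ h (h₁.comp hk) (h₂.comp hk)).trans (comp_fib c' g i l k _ h₂ hk))
    exact congrArg (fun (t : ⦋Y.q i⦌ ⟶ ⦋X.q k⦌) => t.toOrderHom a) this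

theorem mem_range_yoneda {Y D X : Theta2} (g : D ⟶ X) (c : Y ⟶ X) :
    c ∈ (Subfunctor.range (yoneda.map g)).obj (op Y) ↔ ∃ c' : Y ⟶ D, c' ≫ g = c := Iff.rfl

/-- The cellular operator `[id; φ₁, …, φₙ]`. -/
noncomputable def vertical {n : ℕ} {q' q : Fin n → ℕ} (φ : ∀ l, ⦋q' l⦌ ⟶ ⦋q l⦌) :
    (⟨n, q'⟩ : Theta2) ⟶ (⟨n, q⟩ : Theta2) where
  base := 𝟙 _
  fib _ k h := eqToHom (congrArg (fun i => ⦋q' i⦌) h.eq_of_id) ≫ φ k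

/-! ### Vertical faces -/

section vertical

variable {n : ℕ} {q' q : Fin n → ℕ} (φ : ∀ l, ⦋q' l⦌ ⟶ ⦋q l⦌)

theorem vertical_fib (k : Fin n) (h : Covers (𝟙 ⦋n⦌) k k) :
    (vertical φ).fib k k h = φ k := by
  simp [vertical]

theorem comp_vertical_fib {Y : Theta2} (c : Y ⟶ (⟨n, q'⟩ : Theta2)) (l : Fin Y.n) (k : Fin n)
    (h : Covers (c ≫ vertical φ).base l k) (h' : Covers c.base l k) :
    (c ≫ vertical φ).fib l k h = c.fib l k h' ≫ φ k := by
  rw [comp_fib c (vertical φ) l k k h h' (Covers.id k), vertical_fib]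

theorem isFace_vertical (hφ : ∀ l, Function.Injective (φ l).toOrderHom) :
    IsFace (vertical φ) := by
  refine ⟨fun a b h => h, fun l a b h => hφ l ?_⟩
  have := h l (Covers.id l)
  rwa [vertical_fib] at this

theorem exists_comp_vertical_iff (hφ : ∀ l, Function.Injective (φ l).toOrderHom) {Y : Theta2}
    (c : Y ⟶ (⟨n, q⟩ : Theta2)) : (∃ c', c' ≫ vertical φ = c) ↔
      ∀ l k (h : Covers c.base l k),
        Set.range (c.fib l k h).toOrderHom ⊆ Set.range (φ k).toOrderHom := by
  constructor
  · rintro ⟨c', rfl⟩ l k h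
    rw [comp_vertical_fib φ c' l k h h]
    rintro _ ⟨x, rfl⟩
    exact ⟨_, rfl⟩
  · intro H
    refine exists_factor (vertical φ) c c.base (Category.comp_id _) fun l k h => ?_
    obtain ⟨v, hv⟩ := SimplexCategory.exists_lift_of_range_subset _ (φ k) (hφ k) (H l k h)
    refine ⟨v, fun k' h' h'' => ?_⟩
    obtain rfl : k = k' := h'.eq_of_id
    exact (congrArg (v ≫ ·) (vertical_fib φ k h')).trans hv

/-- The vertical faces of `[n; q]` missing the vertex `i` of `[q_j]`. -/
theorem exists_vertical_omitting (q : Fin n → ℕ) (j : Fin n) (i : Fin (q j + 1)) (hq : 0 < q j) :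
    ∃ (q' : Fin n → ℕ) (φ : ∀ l, ⦋q' l⦌ ⟶ ⦋q l⦌), (∀ l, Function.Injective (φ l).toOrderHom) ∧
      ∀ l, Set.range (φ l).toOrderHom = {x | l = j → x.1 ≠ i.1} := by
  have H : ∀ l, ∃ (r : ℕ) (φ : ⦋r⦌ ⟶ ⦋q l⦌), Function.Injective φ.toOrderHom ∧
      Set.range φ.toOrderHom = {x | l = j → x.1 ≠ i.1} := fun l => by
    refine SimplexCategory.exists_mono_range _ ?_
    by_cases hl : l = j
    · subst hl
      by_cases hi : i.1 = 0
      · exact ⟨⟨1, by omega⟩, fun _ => by simp [hi]⟩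
      · exact ⟨0, fun _ => by simpa using fun h => hi h.symm⟩
    · exact ⟨0, fun h => absurd h hl⟩
  choose q' φ h using H
  exact ⟨q', φ, fun l => (h l).1, fun l => (h l).2⟩

end vertical

end Theta2

/-! ### Vertical horns -/

/-- By `hR` the face drops only vertices in `R`, which do not count for membership. Every vertex
that counts has a preimage under `φ`, and omitting one amounts to omitting the other. -/
theorem boxHorn_preimage_vertical {n : ℕ} {q' q : Fin n → ℕ} (φ : ∀ l, ⦋q' l⦌ ⟶ ⦋q l⦌)
    (hφ : ∀ l, Function.Injective (φ l).toOrderHom) (R : ∀ l, Set (Fin (q l + 1)))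
    (hR : ∀ l x, x ∉ R l → x ∈ Set.range (φ l).toOrderHom) :
    (boxHorn q ∅ R).preimage (yoneda.map (Theta2.vertical φ)) =
      boxHorn q' ∅ fun l => (φ l).toOrderHom ⁻¹' R l := by
  ext ⟨Y⟩ (c : Y ⟶ (⟨n, q'⟩ : Theta2))
  change (c ≫ Theta2.vertical φ) ∈ (boxHorn q ∅ R).obj (op Y) ↔ _
  rw [mem_boxHorn, mem_boxHorn]
  refine or_congr Iff.rfl (exists_congr fun k => forall_congr' fun l => forall_congr' fun h => ?_)
  rw [Theta2.comp_vertical_fib φ c l k h h]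
  constructor
  · rintro ⟨x, hx, hx'⟩
    obtain ⟨y, rfl⟩ := hR k x hx
    refine ⟨y, hx, ?_⟩
    rintro ⟨z, rfl⟩
    exact hx' ⟨z, rfl⟩
  · rintro ⟨y, hy, hy'⟩
    refine ⟨_, hy, ?_⟩
    rintro ⟨z, hz⟩
    exact hy' ⟨z, hφ k hz⟩

/-- Adjoining the face opposite to `i` makes the omission of `i` count, that is, it removes `i` from
`R j`. A cell that belongs to the larger horn only because it omits `i` factors through that face.
-/
theorem boxHorn_sup_vertical {n : ℕ} {q' q : Fin n → ℕ} (φ : ∀ l, ⦋q' l⦌ ⟶ ⦋q l⦌)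
    (hφ : ∀ l, Function.Injective (φ l).toOrderHom) (j : Fin n) (i : Fin (q j + 1))
    (hr : ∀ l, Set.range (φ l).toOrderHom = {x | l = j → x.1 ≠ i.1})
    (R : ∀ l, Set (Fin (q l + 1))) :
    boxHorn q ∅ (fun l => R l ∩ {x | l = j → x.1 ≠ i.1}) =
      boxHorn q ∅ R ⊔ Subfunctor.range (yoneda.map (Theta2.vertical φ)) := by
  ext ⟨Y⟩ (c : Y ⟶ (⟨n, q⟩ : Theta2))
  rw [Subfunctor.max_obj, Set.mem_union, Theta2.mem_range_yoneda, mem_boxHorn,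
    mem_boxHorn, Theta2.exists_comp_vertical_iff φ hφ]
  constructor
  · rintro (h | ⟨k, hk⟩)
    · exact Or.inl (Or.inl h)
    · by_cases hA : ∀ l h, ∃ x, x ∉ R k ∧ x ∉ Set.range (c.fib l k h).toOrderHom
      · exact Or.inl (Or.inr ⟨k, hA⟩)
      · push Not at hA
        obtain ⟨l, h, hA⟩ := hA
        obtain ⟨x, hx, hx'⟩ := hk l h
        have hx₁ : x ∈ R k := by
          by_contra hn
          exact hx' (hA x hn)
        have hx₂ : k = j ∧ x.1 = i.1 := by
          by_contra hn
          exact hx ⟨hx₁, fun h h' => hn ⟨h, h'⟩⟩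
        obtain ⟨rfl, hxi⟩ := hx₂
        refine Or.inr fun l' k' h' => ?_
        rw [hr k']
        rintro _ ⟨z, rfl⟩ rfl hz
        obtain rfl := h.unique h'
        exact hx' ⟨z, Fin.ext (hz.trans hxi.symm)⟩
  · rintro ((h | ⟨k, hk⟩) | h)
    · exact Or.inl h
    · refine Or.inr ⟨k, fun l h => ?_⟩
      obtain ⟨x, hx, hx'⟩ := hk l h
      exact ⟨x, fun hn => hx hn.1, hx'⟩
    · refine Or.inr ⟨j, fun l hl => ⟨i, fun hn => hn.2 rfl rfl, fun hn => ?_⟩⟩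
      have := h l j hl hn
      rw [hr j] at this
      exact this rfl rfl

/-- Induction on the number of missing faces, all inner and all in the `j`-th variable. Attach the
face opposite to some `i ∈ R j`: both the horn along which it is attached and the resulting horn
lack one face fewer. One missing face is an inner vertical horn, whence the cardinality `r + 1`. -/
theorem boxHorn_ι_mem_of_innerVerticalHorns (P : MorphismProperty CellSet)
    [P.IsStableUnderCobaseChange] [P.IsStableUnderComposition]
    (hP : (innerVerticalHorns : MorphismProperty CellSet) ≤ P) (r : ℕ) :
    ∀ {n : ℕ} (q : Fin n → ℕ) (j : Fin n) (R : ∀ l, Set (Fin (q l + 1))),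
      (R j).ncard = r + 1 → 0 ∉ R j → Fin.last _ ∉ R j → (∀ l, l ≠ j → R l = ∅) →
      P (boxHorn q ∅ R).ι := by
  have := MorphismProperty.IsStableUnderCobaseChange.respectsIso (P := P)
  induction r with
  | zero =>
    intro n q j R hc h0 h1 hR
    obtain ⟨i, hi⟩ := Set.ncard_eq_one.1 hc
    refine (innerVerticalHorns_iff q j i R hi hR P).1 ?_
    rw [hi] at h0 h1
    exact hP _ _ _ (innerVerticalHorns.mk n q j i (Fin.pos_iff_ne_zero.2 fun h => h0 h.symm)
      (lt_of_le_of_ne (Fin.le_last i) fun h => h1 h.symm))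
  | succ r ih =>
    intro n q j R hc h0 h1 hR
    obtain ⟨i, hi⟩ : (R j).Nonempty := Set.nonempty_of_ncard_ne_zero (by omega)
    have hq : 0 < q j := by
      by_contra hn
      refine h0 (?_ : (0 : Fin _) ∈ R j)
      convert hi
      ext
      have := i.2
      simp only [Fin.val_zero]
      omega
    obtain ⟨q', φ, hφ, hr⟩ := Theta2.exists_vertical_omitting q j i hq
    have hR' : R j ∩ {x | j = j → x.1 ≠ i.1} = R j \ {i} := by
      ext x
      simp [Fin.ext_iff]
    have hcard : (R j \ {i}).ncard = r + 1 := by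
      rw [Set.ncard_sdiff_singleton_of_mem hi, hc]
      rfl
    have := (Theta2.isFace_vertical φ hφ).mono
    refine P.subfunctor_ι_of_glue (yoneda.map (Theta2.vertical φ))
      (boxHorn_sup_vertical φ hφ j i hr R) ?_ ?_
    · rw [boxHorn_preimage_vertical φ hφ R]
      · refine ih q' j _ ?_ ?_ ?_ fun l hl => ?_
        · rw [← hcard, ← Set.ncard_preimage_of_injective_subset_range (hφ j)
            (s := R j \ {i})]
          · congr 1
            ext x
            simp only [Set.mem_preimage, Set.mem_sdiff, Set.mem_singleton_iff, iff_self_and]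
            intro _ hx
            have : (φ j).toOrderHom x ∈ Set.range (φ j).toOrderHom := ⟨x, rfl⟩
            rw [hr j] at this
            exact this rfl (congrArg Fin.val hx)
          · rintro x ⟨-, hx⟩
            rw [hr j]
            exact fun _ h => hx (Fin.ext h)
        -- Since `i` is inner, both extreme vertices lie in the range of `φ j`. Monotonicity then
        -- forces `φ j` to preserve them, so the missing faces stay inner.
        · have h0' : (0 : Fin (q j + 1)) ∈ Set.range (φ j).toOrderHom := by
            rw [hr j]
            exact fun _ h => h0 ((Fin.ext h : (0 : Fin (q j + 1)) = i) ▸ hi)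
          obtain ⟨y, hy⟩ := h0'
          have : (φ j).toOrderHom 0 = 0 :=
            le_antisymm (hy ▸ (φ j).toOrderHom.monotone (Fin.zero_le y)) (Fin.zero_le _)
          exact fun h => h0 (this ▸ h)
        · have h1' : Fin.last (q j) ∈ Set.range (φ j).toOrderHom := by
            rw [hr j]
            exact fun _ h => h1 ((Fin.ext h : Fin.last (q j) = i) ▸ hi)
          obtain ⟨y, hy⟩ := h1'
          have : (φ j).toOrderHom (Fin.last _) = Fin.last _ :=
            le_antisymm (Fin.le_last _) (hy ▸ (φ j).toOrderHom.monotone (Fin.le_last y))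
          exact fun h => h1 (this ▸ h)
        · rw [hR l hl, Set.preimage_empty]
      · intro l x hx
        rw [hr l]
        rintro rfl h
        exact hx ((Fin.ext h : x = i) ▸ hi)
    · refine ih q j _ ?_ (fun h => h0 h.1) (fun h => h1 h.1) fun l hl => ?_
      · rw [hR', hcard]
      · rw [hR l hl]
        simp

/-! ### Combinatorics of shuffles -/

namespace Shuffle

variable {a b : ℕ}

/-- The lattice path of a shuffle: its first coordinate as a function of the natural numbers. -/
noncomputable def path (s : Shuffle a b) (i : ℕ) : ℕ :=
  (s.left.toOrderHom (⟨min i (a + b), by omega⟩ : Fin (a + b + 1))).1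

theorem path_val (s : Shuffle a b) (i : Fin (a + b + 1)) :
    (s.left.toOrderHom i).1 = s.path i.1 := by
  have : (⟨min i.1 (a + b), by omega⟩ : Fin (a + b + 1)) = i := Fin.ext (by simp; omega)
  rw [path, this]

theorem right_val (s : Shuffle a b) (i : Fin (a + b + 1)) :
    (s.right.toOrderHom i).1 = i.1 - s.path i.1 := by
  have := s.add_eq i
  rw [path_val] at this
  omega

theorem path_le (s : Shuffle a b) (i : ℕ) : s.path i ≤ a :=
  Nat.lt_succ_iff.1 (s.left.toOrderHom _).2

theorem path_mono (s : Shuffle a b) : Monotone s.path := fun i j h =>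
  s.left.toOrderHom.monotone (Fin.mk_le_mk.2 (by omega))

theorem path_le_self (s : Shuffle a b) {i : ℕ} (hi : i ≤ a + b) : s.path i ≤ i := by
  have := s.add_eq ⟨i, by omega⟩
  rw [path_val] at this
  dsimp only at this
  omega

theorem le_path_add (s : Shuffle a b) {i : ℕ} (hi : i ≤ a + b) : i ≤ s.path i + b := by
  have := s.add_eq ⟨i, by omega⟩
  have h := (s.right.toOrderHom (⟨i, by omega⟩ : Fin (a + b + 1))).2
  rw [path_val] at this
  simp only [SimplexCategory.len_mk] at this h
  omega

theorem path_zero (s : Shuffle a b) : s.path 0 = 0 :=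
  Nat.le_zero.1 (s.path_le_self (Nat.zero_le _))

theorem path_last (s : Shuffle a b) : s.path (a + b) = a := by
  have h₁ := s.path_le (a + b)
  have h₂ := s.le_path_add le_rfl
  omega

theorem path_succ (s : Shuffle a b) {i : ℕ} (hi : i < a + b) :
    s.path (i + 1) = s.path i ∨ s.path (i + 1) = s.path i + 1 := by
  have h₁ := s.path_mono (Nat.le_succ i)
  have h₂ : (s.right.toOrderHom (⟨i, by omega⟩ : Fin (a + b + 1))).1 ≤
      (s.right.toOrderHom (⟨i + 1, by omega⟩ : Fin (a + b + 1))).1 :=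
    s.right.toOrderHom.monotone (Fin.mk_le_mk.2 (Nat.le_succ i))
  rw [right_val, right_val] at h₂
  have h₃ := s.path_le_self (i := i + 1) hi
  have h₄ := s.path_le_self hi.le
  simp only [Nat.succ_eq_add_one] at *
  omega

theorem ext_path {s t : Shuffle a b} (h : ∀ i ≤ a + b, s.path i = t.path i) : s = t := by
  apply Shuffle.ext
  · ext i : 3
    apply Fin.ext
    rw [path_val, path_val]
    exact h _ (Nat.lt_succ_iff.1 i.2)
  · ext i : 3
    apply Fin.ext
    rw [right_val, right_val, h _ (Nat.lt_succ_iff.1 i.2)]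

theorem exists_eq_of_steps (f : ℕ → ℕ) (n : ℕ) (h0 : f 0 = 0)
    (hs : ∀ i < n, f (i + 1) = f i ∨ f (i + 1) = f i + 1) :
    ∀ x ≤ f n, ∃ i ≤ n, f i = x := by
  induction n with
  | zero => exact fun x hx => ⟨0, le_rfl, by omega⟩
  | succ n ih =>
    intro x hx
    by_cases hx' : x ≤ f n
    · obtain ⟨i, hi, h⟩ := ih (fun i hi => hs i (by omega)) x hx'
      exact ⟨i, by omega, h⟩
    · have := hs n (by omega)
      exact ⟨n + 1, le_rfl, by omega⟩

theorem le_of_steps (f : ℕ → ℕ) (n : ℕ)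
    (hs : ∀ i < n, f (i + 1) = f i ∨ f (i + 1) = f i + 1) {i j : ℕ} (hij : i ≤ j) (hj : j ≤ n) :
    f i ≤ f j ∧ f j ≤ f i + (j - i) := by
  induction j, hij using Nat.le_induction with
  | base => simp
  | succ j hij ih =>
    have h₁ := ih (by omega)
    have h₂ := hs j (by omega)
    omega

/-- A shuffle is determined by its first coordinate `f`, the second being `i - f i`. Steps of size
`0` or `1` make both coordinates monotone and surjective. -/
theorem exists_path (f : ℕ → ℕ) (h0 : f 0 = 0) (h1 : f (a + b) = a)
    (hs : ∀ i < a + b, f (i + 1) = f i ∨ f (i + 1) = f i + 1) :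
    ∃ s : Shuffle a b, ∀ i ≤ a + b, s.path i = f i := by
  have hle : ∀ i ≤ a + b, f i ≤ a := fun i hi => h1 ▸ (le_of_steps f _ hs hi le_rfl).1
  have hle' : ∀ i ≤ a + b, f i ≤ i := fun i hi => by
    have := (le_of_steps f _ hs (Nat.zero_le i) hi).2
    omega
  have hle'' : ∀ i ≤ a + b, i - f i ≤ b := fun i hi => by
    have := (le_of_steps f _ hs hi le_rfl).2
    omega
  let L : ⦋a + b⦌ ⟶ ⦋a⦌ := SimplexCategory.mkHom
    ⟨fun i => ⟨f i.1, Nat.lt_succ_iff.2 (hle _ (Nat.lt_succ_iff.1 i.2))⟩,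
      fun i j hij => (le_of_steps f _ hs hij (Nat.lt_succ_iff.1 j.2)).1⟩
  let R : ⦋a + b⦌ ⟶ ⦋b⦌ := SimplexCategory.mkHom
    ⟨fun i => ⟨i.1 - f i.1, Nat.lt_succ_iff.2 (hle'' _ (Nat.lt_succ_iff.1 i.2))⟩,
      fun i j hij => by
        have h₁ := (le_of_steps f _ hs hij (Nat.lt_succ_iff.1 j.2)).2
        have h₂ : i.1 ≤ j.1 := hij
        have h₃ := hle' _ (Nat.lt_succ_iff.1 i.2)
        simp only [Fin.mk_le_mk]
        omega⟩
  refine ⟨⟨L, R, fun x => ?_, fun y => ?_, fun i => ?_⟩, fun i hi => ?_⟩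
  · obtain ⟨i, hi, h⟩ := exists_eq_of_steps f (a + b) h0 hs x.1
      (by have := x.2; simp only [SimplexCategory.len_mk] at this; omega)
    exact ⟨⟨i, Nat.lt_succ_iff.2 hi⟩, Fin.ext h⟩
  · obtain ⟨i, hi, h⟩ := exists_eq_of_steps (fun i => i - f i) (a + b) (by simp)
      (fun i hi => by have := hs i hi; have := hle' i hi.le; omega) y.1
      (by have := y.2; simp only [SimplexCategory.len_mk] at this; omega)
    exact ⟨⟨i, Nat.lt_succ_iff.2 hi⟩, Fin.ext h⟩
  · exact Nat.add_sub_cancel' (hle' _ (Nat.lt_succ_iff.1 i.2))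
  · change f (min i (a + b)) = f i
    rw [min_eq_left hi]

/-- A chain in `[a] × [b]` lies on the path of some shuffle. -/
theorem exists_path_through {p : ℕ} (x y : Fin (p + 1) → ℕ) (hx : Monotone x) (hy : Monotone y)
    (hxa : ∀ z, x z ≤ a) (hyb : ∀ z, y z ≤ b) :
    ∃ s : Shuffle a b, ∀ z, s.path (x z + y z) = x z := by
  -- A path through `(x z, y z)` has first coordinate at most `x z` up to time `x z + y z`, and at
  -- most `i - y z` afterwards: in both cases the bound is `max (x z) (i - y z)`. Combined with the
  -- bounds `i` and `a`, this describes the largest path through the chain.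
  let m : ℕ → ℕ := fun i => Finset.univ.inf' Finset.univ_nonempty fun z => max (x z) (i - y z)
  have hm : ∀ i z, m i ≤ max (x z) (i - y z) := fun i z => Finset.inf'_le _ (Finset.mem_univ z)
  have hm' : ∀ i, ∃ z, m i = max (x z) (i - y z) := fun i => by
    obtain ⟨z, -, hz⟩ := Finset.exists_mem_eq_inf' Finset.univ_nonempty
      fun z => max (x z) (i - y z)
    exact ⟨z, hz⟩
  let f : ℕ → ℕ := fun i => min (min i a) (m i)
  obtain ⟨s, hs⟩ := exists_path (a := a) (b := b) f (by simp [f]) (by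
      obtain ⟨z, hz⟩ := hm' (a + b)
      have := hyb z
      have : a ≤ m (a + b) := by rw [hz]; omega
      clear hz
      simp only [f]
      omega) (fun i _ => by
      obtain ⟨z, hz⟩ := hm' i
      obtain ⟨z', hz'⟩ := hm' (i + 1)
      have h₁ : m (i + 1) ≤ m i + 1 := (hm (i + 1) z).trans (by rw [hz]; omega)
      have h₂ : m i ≤ m (i + 1) :=
        (hm i z').trans (by rw [hz']; exact max_le_max le_rfl (by omega))
      clear_value m
      clear hz hz' hm hm' hx hy hxa hyb
      simp only [f]
      omega)
  refine ⟨s, fun z => ?_⟩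
  have h₁ := hxa z
  have h₂ := hyb z
  rw [hs _ (by omega)]
  obtain ⟨z', hz'⟩ := hm' (x z + y z)
  have h₃ := hm (x z + y z) z
  -- At time `x z + y z` the bound from `z` is exactly `x z`. Since the points form a chain, no
  -- other point gives a smaller one: later points have larger `x`, earlier points smaller `y`.
  have h₄ : m (x z + y z) = x z := by
    refine le_antisymm (h₃.trans (by omega)) ?_
    rw [hz']
    rcases le_total z z' with h | h
    · exact (hx h).trans (le_max_left _ _)
    · exact le_trans (by have := hy h; omega) (le_max_right _ _)
  simp only [f, h₄]
  omega

/-- The vertices at which a path turns from the second to the first coordinate direction. -/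
def IsCorner (s : Shuffle a b) (i : ℕ) : Prop :=
  ∃ m, i = m + 1 ∧ m + 1 < a + b ∧ s.path (m + 1) = s.path m ∧ s.path (m + 2) = s.path m + 1

/-- The order of attachment. A larger path moves in the first direction earlier, so its corners in
the sense of `IsCorner` are the places where it can be raised. -/
noncomputable instance : PartialOrder (Shuffle a b) where
  le s t := ∀ i ≤ a + b, s.path i ≤ t.path i
  le_refl _ _ _ := le_rfl
  le_trans _ _ _ h h' i hi := (h i hi).trans (h' i hi)
  le_antisymm _ _ h h' := ext_path fun i hi => le_antisymm (h i hi) (h' i hi)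

/-- Where `s` first falls behind `t` it has just moved in the second direction. It must still climb
to `a`, and its next move in the first direction starts at a corner. -/
theorem exists_isCorner {s t : Shuffle a b} (h : ¬ t ≤ s) : ∃ i, s.IsCorner i := by
  classical
  have hex : ∃ i, i ≤ a + b ∧ s.path i < t.path i := by
    by_contra hn
    push Not at hn
    exact h hn
  obtain ⟨hi, hlt⟩ := Nat.find_spec hex
  have hmin : ∀ {m}, m < Nat.find hex → _ := fun {m} h => Nat.find_min hex h
  generalize Nat.find hex = i at *
  have hi0 : i ≠ 0 := by
    rintro rfl
    rw [path_zero, path_zero] at hlt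
    exact lt_irrefl _ hlt
  obtain ⟨i, rfl⟩ := Nat.exists_eq_succ_of_ne_zero hi0
  have h₁ := hmin (Nat.lt_succ_self i)
  have h₂ := s.path_succ (i := i) (by omega)
  have h₃ := t.path_succ (i := i) (by omega)
  have hflat : s.path (i + 1) = s.path i := by
    simp only [Nat.succ_eq_add_one] at *
    by_contra hn
    have : ¬ s.path i < t.path i := fun h => h₁ ⟨by omega, h⟩
    omega
  -- The first later time at which `s` has climbed has the form `m + 2`; the corner is `m + 1`.
  have hex' : ∃ m, i + 1 ≤ m ∧ s.path i < s.path m := ⟨a + b, hi, by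
    have := t.path_le (i + 1)
    rw [path_last]
    simp only [Nat.succ_eq_add_one] at *
    omega⟩
  obtain ⟨hj, hjlt⟩ := Nat.find_spec hex'
  have hjmin : ∀ {m}, m < Nat.find hex' → _ := fun {m} h => Nat.find_min hex' h
  have hjle : Nat.find hex' ≤ a + b := Nat.find_min' hex' ⟨hi, by
    have := t.path_le (i + 1)
    rw [path_last]
    simp only [Nat.succ_eq_add_one] at *
    omega⟩
  generalize Nat.find hex' = j at *
  obtain ⟨m, rfl⟩ : ∃ m, j = m + 2 := by
    have : j ≠ i + 1 := by
      rintro rfl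
      omega
    exact ⟨j - 2, by omega⟩
  have hm₁ : s.path (m + 1) = s.path i := by
    have := hjmin (Nat.lt_succ_self (m + 1))
    have h' : i + 1 ≤ m + 1 := by
      have : m + 2 ≠ i + 1 := by
        intro h
        rw [h] at hjlt
        omega
      omega
    have h'' := s.path_mono (show i ≤ m + 1 by omega)
    by_contra hn
    exact this ⟨h', by omega⟩
  have hm₂ : s.path m = s.path i := by
    have h' : i ≤ m := by
      have : m + 2 ≠ i + 1 := by
        intro h
        rw [h] at hjlt
        omega
      omega
    have h₁ := s.path_mono h'
    have h₂ := s.path_mono (Nat.le_succ m)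
    simp only [Nat.succ_eq_add_one] at *
    omega
  have := s.path_succ (i := m + 1) (by omega)
  exact ⟨m + 1, m, rfl, by omega, by omega, by
    change s.path (m + 2) = _ ∨ s.path (m + 2) = _ at this
    omega⟩

/-- A path can be lowered at a vertex where it turns from the first to the second direction. -/
theorem exists_lt_of_turn (s : Shuffle a b) {m : ℕ} (hm : m + 1 < a + b)
    (h₁ : s.path (m + 1) = s.path m + 1) (h₂ : s.path (m + 2) = s.path (m + 1)) :
    ∃ t : Shuffle a b, t < s ∧ ∀ i ≤ a + b, i ≠ m + 1 → t.path i = s.path i := by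
  obtain ⟨t, ht⟩ := exists_path (a := a) (b := b)
    (fun i => if i = m + 1 then s.path m else s.path i) (by simp [path_zero])
    (by rw [if_neg (by omega), path_last]) (fun i hi => by
      have := s.path_succ hi
      by_cases hi₁ : i = m
      · subst hi₁
        simp
      · by_cases hi₂ : i = m + 1
        · subst hi₂
          simp [h₁, h₂]
        · simpa [hi₁, hi₂] using this)
  refine ⟨t, lt_of_le_of_ne (fun i hi => ?_) ?_, fun i hi hne => ?_⟩
  · rw [ht i hi]
    split_ifs with h
    · rw [h]
      omega
    · exact le_rfl
  · rintro rfl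
    have := ht (m + 1) (by omega)
    simp at this
    omega
  · rw [ht i hi, if_neg hne]

/-- Let `T` be a lower set of shuffles and `s` a minimal element of its complement. A set `I` of
vertices of the path of `s` omits a coordinate or lies on a path in `T` if and only if it does not
contain all vertices which are not corners. -/
theorem omits_iff {T : Set (Shuffle a b)} (hT : IsLowerSet T) {s : Shuffle a b} (hs : s ∉ T)
    (hs' : ∀ t < s, t ∈ T) (I : Set ℕ) (hI : ∀ i ∈ I, i ≤ a + b) :
    ((∃ x ≤ a, ∀ i ∈ I, s.path i ≠ x) ∨ (∃ y ≤ b, ∀ i ∈ I, i - s.path i ≠ y) ∨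
      ∃ t ∈ T, ∀ i ∈ I, t.path i = s.path i) ↔ ∃ i ≤ a + b, ¬ s.IsCorner i ∧ i ∉ I := by
  classical
  constructor
  · intro h
    by_contra hn
    push Not at hn
    rcases h with ⟨x, hx, h⟩ | ⟨y, hy, h⟩ | ⟨t, ht, h⟩
    -- The first vertex of the path with first coordinate `x` is not a corner, since a corner is
    -- reached by a move in the second direction.
    · have hex : ∃ i, x ≤ s.path i := ⟨a + b, by rwa [path_last]⟩
      have h₁ := Nat.find_spec hex
      have h₂ : Nat.find hex ≤ a + b := Nat.find_min' hex (by rwa [path_last])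
      have h₃ : ∀ {m}, m < Nat.find hex → _ := fun {m} h => Nat.find_min hex h
      generalize Nat.find hex = i at *
      have h₄ : s.path i = x := by
        rcases Nat.eq_zero_or_pos i with rfl | hi
        · rw [path_zero] at h₁ ⊢
          omega
        · obtain ⟨i, rfl⟩ := Nat.exists_eq_succ_of_ne_zero hi.ne'
          have := h₃ (Nat.lt_succ_self i)
          have := s.path_succ (i := i) (by omega)
          simp only [Nat.succ_eq_add_one] at *
          omega
      refine h i (hn i h₂ ?_) h₄
      rintro ⟨m, rfl, -, hm, -⟩
      have := h₃ (Nat.lt_succ_self m)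
      omega
    -- The last vertex of the path with second coordinate `y` is not a corner, since a corner is
    -- left by a move in the first direction.
    · let i := Nat.findGreatest (fun i => i - s.path i ≤ y) (a + b)
      have h₁ : i - s.path i ≤ y :=
        Nat.findGreatest_spec (P := fun i => i - s.path i ≤ y) (Nat.zero_le _) (by simp)
      have h₂ : i ≤ a + b := Nat.findGreatest_le _
      have h₃ : ∀ m, i < m → m ≤ a + b → ¬ (m - s.path m ≤ y) := fun m hm hm' =>
        Nat.findGreatest_is_greatest (P := fun i => i - s.path i ≤ y) hm hm'
      clear_value i
      have h₅ := s.path_le_self h₂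
      have h₄ : i - s.path i = y := by
        rcases h₂.eq_or_lt with rfl | hi
        · rw [path_last] at h₁ ⊢
          omega
        · have := h₃ (i + 1) (by omega) hi
          have := s.path_succ hi
          omega
      refine h i (hn i h₂ ?_) h₄
      rintro ⟨m, rfl, hm, hm₁, hm₂⟩
      have := h₃ (m + 2) (by omega) hm
      omega
    -- If `t` agrees with `s` off the corners, then `s ≤ t`. At a corner `m + 1` the preceding
    -- vertex `m` is not a corner, and `s.path (m + 1) = s.path m = t.path m ≤ t.path (m + 1)`.
    -- Since `T` is a lower set, this would put `s` in `T`.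
    · refine hs (hT (fun i hi => ?_ : s ≤ t) ht)
      by_cases hc : s.IsCorner i
      · obtain ⟨m, rfl, hm, hm₁, hm₂⟩ := hc
        have h₁ : m ∈ I := by
          refine hn m (by omega) ?_
          rintro ⟨r, rfl, -, hr, hr'⟩
          simp only [show r + 1 + 1 = r + 2 from rfl] at *
          omega
        have h₂ := h m h₁
        have := t.path_mono (Nat.le_succ m)
        simp only [Nat.succ_eq_add_one] at *
        omega
      · exact (h i (hn i hi hc)).ge
  · rintro ⟨i, hi, hc, hiI⟩
    have hlt : ∀ j ∈ I, j < i ∨ i < j := fun j hj =>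
      lt_or_gt_of_ne fun h => hiI (h ▸ hj)
    -- A non-corner reached in the second direction is also left in it, or is the end. It is then
    -- the only vertex with its second coordinate, and omitting it omits that coordinate.
    by_cases hin : ∃ m, i = m + 1 ∧ s.path (m + 1) = s.path m
    · obtain ⟨m, rfl, hm⟩ := hin
      refine Or.inr (Or.inl ⟨m + 1 - s.path (m + 1), ?_, fun j hj h => ?_⟩)
      · have := s.le_path_add hi
        omega
      · have h₀ := s.path_le_self (hI j hj)
        have h₁ := s.path_le_self hi
        rcases hlt j hj with hj' | hj'
        · have h₂ := (le_of_steps s.path _ (fun i hi => s.path_succ hi)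
            (show j ≤ m by omega) (by omega)).2
          omega
        · have h₂ := (le_of_steps s.path _ (fun i hi => s.path_succ hi)
            (show m + 2 ≤ j by omega) (hI j hj)).2
          have h₃ := s.path_succ (i := m + 1) (by have := hI j hj; omega)
          have h₄ : s.path (m + 2) ≠ s.path m + 1 := fun h =>
            hc ⟨m, rfl, by have := hI j hj; omega, hm, h⟩
          simp only [show m + 1 + 1 = m + 2 from rfl] at *
          omega
    -- Left in the second direction: the starting vertex is the only one with second coordinate `0`.
    -- Otherwise the path turns from the first direction to the second here, and lowering it at `i`
    -- gives a smaller shuffle, hence one in `T`.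
    · by_cases hout : i < a + b ∧ s.path (i + 1) = s.path i
      · by_cases hi0 : i = 0
        · subst hi0
          refine Or.inr (Or.inl ⟨0, Nat.zero_le _, fun j hj h => ?_⟩)
          have hj' := hlt j hj
          have h₂ := (le_of_steps s.path _ (fun i hi => s.path_succ hi)
            (show 0 + 1 ≤ j by omega) (hI j hj)).2
          have h₃ := s.path_zero
          omega
        · obtain ⟨m, rfl⟩ := Nat.exists_eq_succ_of_ne_zero hi0
          have h₁ : s.path (m + 1) = s.path m + 1 :=
            (s.path_succ (by omega)).resolve_left fun h => hin ⟨m, rfl, h⟩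
          obtain ⟨t, ht, h⟩ := s.exists_lt_of_turn hout.1 h₁ hout.2
          exact Or.inr (Or.inr ⟨t, hs' t ht, fun j hj =>
            h j (hI j hj) fun h => hiI ((show j = m.succ from h) ▸ hj)⟩)
      -- No move in the second direction is adjacent to `i`, so `i` is the only vertex with its
      -- first coordinate.
      · refine Or.inl ⟨s.path i, s.path_le i, fun j hj h => ?_⟩
        rcases hlt j hj with hj' | hj'
        · obtain ⟨m, rfl⟩ := Nat.exists_eq_succ_of_ne_zero (show i ≠ 0 by omega)
          have h₁ := (s.path_succ (i := m) (by omega)).resolve_left fun h => hin ⟨m, rfl, h⟩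
          have h₂ := s.path_mono (show j ≤ m by omega)
          simp only [Nat.succ_eq_add_one] at *
          omega
        · have h₁ := s.path_mono (show i + 1 ≤ j from hj')
          have h₂ : i < a + b := by have := hI j hj; omega
          have h₃ := (s.path_succ h₂).resolve_left fun h => hout ⟨h₂, h⟩
          omega

end Shuffle

/-! ### Horizontal hyperfaces -/

theorem SimplexCategory.eqToHom_val {a b : ℕ} (h : ⦋a⦌ = ⦋b⦌) (x : Fin (a + 1)) :
    ((eqToHom h).toOrderHom x).1 = x.1 := by
  obtain rfl : a = b := congrArg SimplexCategory.len h
  rfl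

theorem SimplexCategory.eqToHom_comp_val {a b c d : ℕ} (h : ⦋a⦌ = ⦋b⦌) (f : ⦋b⦌ ⟶ ⦋c⦌)
    (h' : ⦋c⦌ = ⦋d⦌) (F : ℕ → ℕ) (hF : ∀ x, (f.toOrderHom x).1 = F x.1) (x : Fin (a + 1)) :
    ((eqToHom h ≫ f ≫ eqToHom h').toOrderHom x).1 = F x.1 := by
  obtain rfl : a = b := congrArg SimplexCategory.len h
  obtain rfl : c = d := congrArg SimplexCategory.len h'
  exact hF x

theorem Covers.left_of_comp {m n r : ℕ} {α : ⦋m⦌ ⟶ ⦋n⦌} {β : ⦋n⦌ ⟶ ⦋r⦌} {i : Fin m} {l : Fin n}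
    {k : Fin r} (h : Covers (α ≫ β) i k) (h' : Covers β l k) : Covers α i l := by
  obtain rfl : h.mid = l := h.mid_right.unique h'
  exact h.mid_left

namespace Theta2

variable {N : ℕ} {q : Fin (N + 2) → ℕ} {j : Fin (N + 1)}

/-- The edges of `[N + 2]`, other than `j + 1`, numbered by the edges of `[N + 1]` covering them
along `δ^{j + 1}`. -/
abbrev edge (j l : Fin (N + 1)) : Fin (N + 2) := j.succ.succAbove l

theorem covers_delta_edge (j l : Fin (N + 1)) :
    Covers (SimplexCategory.δ j.succ.castSucc) l (edge j l) := by
  constructor <;>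
  · simp only [edge, SimplexCategory.δ, SimplexCategory.mkHom, SimplexCategory.Hom.toOrderHom_mk,
      OrderEmbedding.toOrderHom_coe, Fin.succAboveOrderEmb_apply, Fin.succAbove, Fin.lt_def,
      Fin.le_def, Fin.val_castSucc, Fin.val_succ]
    split_ifs <;> simp only [Fin.val_castSucc, Fin.val_succ] <;> omega

theorem edge_self (j : Fin (N + 1)) : edge j j = j.castSucc := by
  simp [edge, Fin.succAbove, Fin.lt_def]

theorem covers_delta_castSucc (j : Fin (N + 1)) :
    Covers (SimplexCategory.δ j.succ.castSucc) j j.castSucc := edge_self j ▸ covers_delta_edge j j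

theorem covers_delta_succ (j : Fin (N + 1)) :
    Covers (SimplexCategory.δ j.succ.castSucc) j j.succ := by
  constructor <;>
  · simp only [SimplexCategory.δ, SimplexCategory.mkHom, SimplexCategory.Hom.toOrderHom_mk,
      OrderEmbedding.toOrderHom_coe, Fin.succAboveOrderEmb_apply, Fin.succAbove, Fin.lt_def,
      Fin.le_def, Fin.val_castSucc, Fin.val_succ]
    split_ifs <;> simp only [Fin.val_castSucc, Fin.val_succ] at * <;> omega

theorem eq_succ_or_exists_edge (j : Fin (N + 1)) (k : Fin (N + 2)) :
    k = j.succ ∨ ∃ l, k = edge j l := by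
  by_cases h : k = j.succ
  · exact Or.inl h
  · obtain ⟨l, hl⟩ := Fin.exists_succAbove_eq h
    exact Or.inr ⟨l, hl.symm⟩

theorem edge_ne (j : Fin (N + 1)) {l : Fin (N + 1)} (hl : l ≠ j) :
    edge j l ≠ j.castSucc ∧ edge j l ≠ j.succ :=
  ⟨fun h => hl (Fin.succAbove_right_injective (h.trans (edge_self j).symm)),
    Fin.succAbove_ne _ _⟩

theorem mergeObj_q_self (q : Fin (N + 2) → ℕ) (j : Fin (N + 1)) :
    (mergeObj q j).q j = q j.castSucc + q j.succ := by simp [mergeObj]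

theorem mergeObj_q_of_ne (q : Fin (N + 2) → ℕ) (j : Fin (N + 1)) {l : Fin (N + 1)} (hl : l ≠ j) :
    (mergeObj q j).q l = q (edge j l) :=
  mergeObj_other q (covers_delta_edge j l) (edge_ne j hl).1 (edge_ne j hl).2

/-! ### Vertex maps of the horizontal hyperfaces, computed in `ℕ` to remove the transports -/

section fib

variable (s : Shuffle (q j.castSucc) (q j.succ))

theorem horizontalHyperface_fib_left (l : Fin (N + 1))
    (h : Covers (SimplexCategory.δ j.succ.castSucc) l j.castSucc)
    (x : Fin ((mergeObj q j).q l + 1)) :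
    (((horizontalHyperface q j s).fib l j.castSucc h).toOrderHom x).1 = s.path x.1 := by
  simp only [horizontalHyperface, dif_pos]
  exact SimplexCategory.eqToHom_comp_val _ _ _ s.path s.path_val x

theorem horizontalHyperface_fib_right (l : Fin (N + 1))
    (h : Covers (SimplexCategory.δ j.succ.castSucc) l j.succ)
    (x : Fin ((mergeObj q j).q l + 1)) :
    (((horizontalHyperface q j s).fib l j.succ h).toOrderHom x).1 = x.1 - s.path x.1 := by
  have hne : j.succ ≠ j.castSucc := by simp [Fin.ext_iff]
  simp only [horizontalHyperface, dif_pos, dif_neg hne]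
  exact SimplexCategory.eqToHom_comp_val _ _ _ (fun i => i - s.path i) s.right_val x

theorem horizontalHyperface_fib_edge {l : Fin (N + 1)} (hl : l ≠ j)
    (h : Covers (SimplexCategory.δ j.succ.castSucc) l (edge j l))
    (x : Fin ((mergeObj q j).q l + 1)) :
    (((horizontalHyperface q j s).fib l (edge j l) h).toOrderHom x).1 = x.1 := by
  simp only [horizontalHyperface, dif_neg (edge_ne j hl).1, dif_neg (edge_ne j hl).2]
  exact SimplexCategory.eqToHom_val _ x

variable {Y : Theta2} (c : Y ⟶ mergeObj q j) {i : Fin Y.n}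

theorem covers_comp_edge_iff {l : Fin (N + 1)} :
    Covers (c ≫ horizontalHyperface q j s).base i (edge j l) ↔ Covers c.base i l := by
  constructor
  · exact fun h => Covers.left_of_comp (α := c.base) h (covers_delta_edge j l)
  · exact fun h => h.comp (covers_delta_edge j l)

theorem covers_comp_castSucc_iff :
    Covers (c ≫ horizontalHyperface q j s).base i j.castSucc ↔ Covers c.base i j := by
  rw [← covers_comp_edge_iff s, edge_self]

theorem covers_comp_succ_iff :
    Covers (c ≫ horizontalHyperface q j s).base i j.succ ↔ Covers c.base i j := by
  constructor
  · exact fun h => Covers.left_of_comp (α := c.base) h (covers_delta_succ j)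
  · exact fun h => h.comp (covers_delta_succ j)

theorem comp_horizontalHyperface_fib_left
    (h : Covers (c ≫ horizontalHyperface q j s).base i j.castSucc) (h' : Covers c.base i j)
    (x : Fin (Y.q i + 1)) :
    (((c ≫ horizontalHyperface q j s).fib i j.castSucc h).toOrderHom x).1 =
      s.path ((c.fib i j h').toOrderHom x).1 := by
  rw [comp_fib c (horizontalHyperface q j s) i j j.castSucc h h' (covers_delta_castSucc j)]
  exact horizontalHyperface_fib_left s _ _ _

theorem comp_horizontalHyperface_fib_right
    (h : Covers (c ≫ horizontalHyperface q j s).base i j.succ) (h' : Covers c.base i j)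
    (x : Fin (Y.q i + 1)) :
    (((c ≫ horizontalHyperface q j s).fib i j.succ h).toOrderHom x).1 =
      ((c.fib i j h').toOrderHom x).1 - s.path ((c.fib i j h').toOrderHom x).1 := by
  rw [comp_fib c (horizontalHyperface q j s) i j j.succ h h' (covers_delta_succ j)]
  exact horizontalHyperface_fib_right s _ _ _

theorem comp_horizontalHyperface_fib_edge {l : Fin (N + 1)} (hl : l ≠ j)
    (h : Covers (c ≫ horizontalHyperface q j s).base i (edge j l)) (h' : Covers c.base i l)
    (x : Fin (Y.q i + 1)) :
    (((c ≫ horizontalHyperface q j s).fib i (edge j l) h).toOrderHom x).1 =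
      ((c.fib i l h').toOrderHom x).1 := by
  rw [comp_fib c (horizontalHyperface q j s) i l _ h h' (covers_delta_edge j l)]
  exact horizontalHyperface_fib_edge s hl _ _

theorem le_of_mem_fib (h : Covers c.base i j) (x : Fin (Y.q i + 1)) :
    ((c.fib i j h).toOrderHom x).1 ≤ q j.castSucc + q j.succ := by
  have := ((c.fib i j h).toOrderHom x).2
  have h' := mergeObj_q_self q j
  simp only [SimplexCategory.len_mk] at this
  omega

theorem isFace_horizontalHyperface : IsFace (horizontalHyperface q j s) := by
  refine ⟨fun x y h => Fin.succAbove_right_injective h, fun l x y h => ?_⟩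
  by_cases hl : l = j
  · replace hl := hl.symm
    subst hl
    have h₁ := congrArg Fin.val (h j.castSucc (covers_delta_castSucc j))
    have h₂ := congrArg Fin.val (h j.succ (covers_delta_succ j))
    rw [horizontalHyperface_fib_left, horizontalHyperface_fib_left] at h₁
    rw [horizontalHyperface_fib_right, horizontalHyperface_fib_right] at h₂
    have hm := mergeObj_q_self q j
    have hx := s.path_le_self (i := x.1) (by omega)
    have hy := s.path_le_self (i := y.1) (by omega)
    exact Fin.ext (by omega)
  · have h₁ := congrArg Fin.val (h (edge j l) (covers_delta_edge j l))
    rw [horizontalHyperface_fib_edge s hl, horizontalHyperface_fib_edge s hl] at h₁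
    exact Fin.ext h₁

end fib

theorem dim_mergeObj (q : Fin (N + 2) → ℕ) (j : Fin (N + 1)) :
    (mergeObj q j).dim + 1 = dim ⟨N + 2, q⟩ := by
  have h : ∀ l : Fin (N + 1), (mergeObj q j).q l = q (edge j l) + if l = j then q j.succ else 0 := fun l => by
    by_cases hl : l = j
    · subst hl
      rw [mergeObj_q_self, edge_self, if_pos rfl]
    · rw [mergeObj_q_of_ne q j hl, if_neg hl, add_zero]
  have h₁ : ∑ l : Fin (N + 1), (mergeObj q j).q l = ∑ l, q (edge j l) + q j.succ := by
    rw [Finset.sum_congr rfl fun l _ => h l, Finset.sum_add_distrib]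
    congr 1
    exact (Finset.sum_ite_eq' Finset.univ j fun _ => q j.succ).trans (if_pos (Finset.mem_univ _))
  have h₂ : ∑ k, q k = q j.succ + ∑ l, q (edge j l) := Fin.sum_univ_succAbove q j.succ
  change N + 1 + ∑ l : Fin (N + 1), (mergeObj q j).q l + 1 = N + 2 + ∑ k, q k
  omega

theorem isHyperface_horizontalHyperface (s : Shuffle (q j.castSucc) (q j.succ)) :
    IsHyperface (horizontalHyperface q j s) :=
  ⟨isFace_horizontalHyperface s, dim_mergeObj q j⟩

theorem range_delta (j : Fin (N + 1)) :
    Set.range (SimplexCategory.δ (n := N + 1) j.succ.castSucc).toOrderHom =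
      {j.succ.castSucc}ᶜ :=
  Fin.range_succAbove _

/-- Along the merged edge the two coordinates of `c` form a chain in a product of two ordinals, and
every chain lies on a maximal lattice path. -/
theorem exists_mem_range_horizontalHyperface {Y : Theta2} (c : Y ⟶ (⟨N + 2, q⟩ : Theta2))
    (hc : j.succ.castSucc ∉ Set.range c.base.toOrderHom) :
    ∃ (s : Shuffle (q j.castSucc) (q j.succ)) (c' : Y ⟶ mergeObj q j),
      c' ≫ horizontalHyperface q j s = c := by
  obtain ⟨u, hu⟩ := SimplexCategory.exists_lift_of_range_subset c.base
    (SimplexCategory.δ (n := N + 1) j.succ.castSucc) Fin.succAbove_right_injective (by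
      rw [range_delta]
      rintro _ ⟨x, rfl⟩ h
      exact hc ⟨x, h⟩)
  have hcov : ∀ {i l k}, Covers u i l → Covers (SimplexCategory.δ j.succ.castSucc) l k →
      Covers c.base i k := fun h h' => hu ▸ h.comp h'
  have key : ∃ s : Shuffle (q j.castSucc) (q j.succ), ∀ i (h : Covers u i j) z,
      s.path (((c.fib i j.castSucc (hcov h (covers_delta_castSucc j))).toOrderHom z).1 +
        ((c.fib i j.succ (hcov h (covers_delta_succ j))).toOrderHom z).1) =
      ((c.fib i j.castSucc (hcov h (covers_delta_castSucc j))).toOrderHom z).1 := by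
    by_cases h : ∃ i, Covers u i j
    · obtain ⟨i, h⟩ := h
      obtain ⟨s, hs⟩ := Shuffle.exists_path_through (a := q j.castSucc) (b := q j.succ)
        (fun z : Fin (Y.q i + 1) =>
          ((c.fib i j.castSucc (hcov h (covers_delta_castSucc j))).toOrderHom z).1)
        (fun z => ((c.fib i j.succ (hcov h (covers_delta_succ j))).toOrderHom z).1)
        (fun z z' hz => (c.fib i j.castSucc _).toOrderHom.monotone hz)
        (fun z z' hz => (c.fib i j.succ _).toOrderHom.monotone hz)
        (fun z => Nat.lt_succ_iff.1 (Fin.is_lt _)) (fun z => Nat.lt_succ_iff.1 (Fin.is_lt _))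
      refine ⟨s, fun i' h' => ?_⟩
      obtain rfl := h'.unique h
      exact hs
    -- If no edge covers the merged one, any shuffle works; a constant chain at the origin supplies
    -- one.
    · obtain ⟨s, -⟩ := Shuffle.exists_path_through (a := q j.castSucc) (b := q j.succ) (p := 0)
        (fun _ => 0) (fun _ => 0) (fun _ _ _ => le_rfl) (fun _ _ _ => le_rfl)
        (fun _ => Nat.zero_le _) (fun _ => Nat.zero_le _)
      exact ⟨s, fun i h' => absurd ⟨i, h'⟩ h⟩
  obtain ⟨s, hs⟩ := key
  refine ⟨s, exists_factor (horizontalHyperface q j s) c u hu fun i l h => ?_⟩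
  by_cases hl : l = j
  · replace hl := hl.symm
    subst hl
    -- A path visits the point `(x, y)` at time `x + y`.
    let v : ⦋Y.q i⦌ ⟶ ⦋(mergeObj q j).q j⦌ := SimplexCategory.mkHom
      ⟨fun z => ⟨((c.fib i j.castSucc (hcov h (covers_delta_castSucc j))).toOrderHom z).1 +
          ((c.fib i j.succ (hcov h (covers_delta_succ j))).toOrderHom z).1, by
            have h₁ := ((c.fib i j.castSucc (hcov h (covers_delta_castSucc j))).toOrderHom z).2
            have h₂ := ((c.fib i j.succ (hcov h (covers_delta_succ j))).toOrderHom z).2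
            simp only [SimplexCategory.len_mk] at h₁ h₂ ⊢
            rw [mergeObj_q_self]
            omega⟩,
        fun z z' hz => Fin.mk_le_mk.2 (add_le_add ((c.fib i j.castSucc _).toOrderHom.monotone hz)
          ((c.fib i j.succ _).toOrderHom.monotone hz))⟩
    refine ⟨v, fun k h' h'' => ?_⟩
    ext z : 3
    apply Fin.ext
    by_cases hk : k = j.castSucc
    · subst hk
      exact (horizontalHyperface_fib_left s j h' _).trans (hs i h z)
    · by_cases hk' : k = j.succ
      · subst hk'
        refine (horizontalHyperface_fib_right s j h' _).trans ?_
        have := hs i h z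
        change _ + _ - s.path (_ + _) = _
        rw [this]
        exact Nat.add_sub_cancel_left _ _
      · exact absurd rfl ((Covers_delta h').2.2 hk hk').1
  · let v : ⦋Y.q i⦌ ⟶ ⦋(mergeObj q j).q l⦌ := SimplexCategory.mkHom
      ⟨fun z => ⟨((c.fib i (edge j l) (hcov h (covers_delta_edge j l))).toOrderHom z).1, by
            have h₁ := ((c.fib i (edge j l) (hcov h (covers_delta_edge j l))).toOrderHom z).2
            simp only [SimplexCategory.len_mk] at h₁ ⊢
            rw [mergeObj_q_of_ne q j hl]
            exact h₁⟩,
        fun z z' hz => (c.fib i (edge j l) _).toOrderHom.monotone hz⟩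
    refine ⟨v, fun k h' h'' => ?_⟩
    obtain rfl : k = edge j l := by
      rcases eq_succ_or_exists_edge j k with rfl | ⟨l', rfl⟩
      · exact absurd (h'.unique (covers_delta_succ j)) hl
      · rw [h'.unique (covers_delta_edge j l')]
    ext z : 3
    exact Fin.ext (horizontalHyperface_fib_edge s hl h' _)

end Theta2

open Theta2

/-! ### Attaching the horizontal hyperfaces shuffle by shuffle -/

section

variable {N : ℕ} (q : Fin (N + 2) → ℕ) (j : Fin (N + 1))

/-- The union of the `(j + 1)`-st horizontal horn of `[N + 2; q]` and the horizontal hyperfaces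
indexed by the shuffles in `T`. -/
noncomputable def shuffleHorn (T : Set (Shuffle (q j.castSucc) (q j.succ))) :
    Subfunctor (yoneda.obj (⟨N + 2, q⟩ : Theta2)) :=
  boxHorn q {j.succ.castSucc} (fun _ => ∅) ⊔
    ⨆ t ∈ T, Subfunctor.range (yoneda.map (horizontalHyperface q j t))

variable {q j}

theorem mem_shuffleHorn {T : Set (Shuffle (q j.castSucc) (q j.succ))} {Y : Theta2}
    (c : Y ⟶ (⟨N + 2, q⟩ : Theta2)) :
    c ∈ (shuffleHorn q j T).obj (op Y) ↔
      c ∈ (boxHorn q {j.succ.castSucc} fun _ => ∅).obj (op Y) ∨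
        ∃ t ∈ T, ∃ c', c' ≫ horizontalHyperface q j t = c := by
  rw [shuffleHorn, Subfunctor.max_obj, Set.mem_union, Subfunctor.iSup_obj, Set.mem_iUnion]
  refine or_congr Iff.rfl (exists_congr fun t => ?_)
  rw [Subfunctor.iSup_obj, Set.mem_iUnion, exists_prop, mem_range_yoneda]

theorem shuffleHorn_empty :
    shuffleHorn q j ∅ = boxHorn q {j.succ.castSucc} fun _ => ∅ := by
  simp [shuffleHorn]

theorem shuffleHorn_insert (s : Shuffle (q j.castSucc) (q j.succ))
    (T : Set (Shuffle (q j.castSucc) (q j.succ))) :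
    shuffleHorn q j (insert s T) =
      shuffleHorn q j T ⊔ Subfunctor.range (yoneda.map (horizontalHyperface q j s)) := by
  rw [shuffleHorn, shuffleHorn, iSup_insert, sup_assoc]
  congr 1
  exact sup_comm _ _

/-- The position on a path is the sum of the two coordinates, hence the same for both paths. A
common cell of two hyperfaces therefore uses only positions where the paths agree. -/
theorem comp_horizontalHyperface_eq_iff (s t : Shuffle (q j.castSucc) (q j.succ)) {Y : Theta2}
    (c : Y ⟶ mergeObj q j) :
    (∃ c', c' ≫ horizontalHyperface q j t = c ≫ horizontalHyperface q j s) ↔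
      ∀ i (h : Covers c.base i j) x, t.path ((c.fib i j h).toOrderHom x).1 =
        s.path ((c.fib i j h).toOrderHom x).1 := by
  constructor
  · rintro ⟨c', hc'⟩ i h x
    have key : ∀ (d d' : Y ⟶ (⟨N + 2, q⟩ : Theta2)) (_ : d = d') k (h : Covers d.base i k)
        (h' : Covers d'.base i k),
        ((d.fib i k h).toOrderHom x).1 = ((d'.fib i k h').toOrderHom x).1 := by
      rintro d _ rfl k h h'
      rfl
    have hl := (covers_comp_castSucc_iff s c).2 h
    have hr := (covers_comp_succ_iff s c).2 h
    have hl' : Covers (c' ≫ horizontalHyperface q j t).base i j.castSucc := hc' ▸ hl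
    have hr' : Covers (c' ≫ horizontalHyperface q j t).base i j.succ := hc' ▸ hr
    have h' := (covers_comp_castSucc_iff t c').1 hl'
    have h₁ := key _ _ hc' _ hl' hl
    have h₂ := key _ _ hc' _ hr' hr
    rw [comp_horizontalHyperface_fib_left t c' _ h', comp_horizontalHyperface_fib_left s c _ h] at h₁
    rw [comp_horizontalHyperface_fib_right t c' _ h',
      comp_horizontalHyperface_fib_right s c _ h] at h₂
    have h₃ := t.path_le_self (le_of_mem_fib c' h' x)
    have h₄ := s.path_le_self (le_of_mem_fib c h x)
    rwa [show ((c'.fib i j h').toOrderHom x).1 = ((c.fib i j h).toOrderHom x).1 by omega] at h₁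
  · intro H
    refine ⟨c, Hom.ext' rfl fun i k h h' => ?_⟩
    ext x : 3
    apply Fin.ext
    rcases eq_succ_or_exists_edge j k with rfl | ⟨l, rfl⟩
    · have hc := (covers_comp_succ_iff s c).1 h'
      exact (comp_horizontalHyperface_fib_right t c h hc x).trans
        ((congrArg _ (H i hc x)).trans (comp_horizontalHyperface_fib_right s c h' hc x).symm)
    · have hc := (covers_comp_edge_iff s c).1 h'
      by_cases hl : l = j
      · replace hl := hl.symm
        subst hl
        have e := edge_self j
        revert h h'
        rw [e]
        intro h h'
        exact (comp_horizontalHyperface_fib_left t c h hc x).trans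
          ((H i hc x).trans (comp_horizontalHyperface_fib_left s c h' hc x).symm)
      · exact (comp_horizontalHyperface_fib_edge t c hl h hc x).trans
          (comp_horizontalHyperface_fib_edge s c hl h' hc x).symm

/-- For a cell with surjective base, the conditions on the other edges agree on both sides. On the
merged edge the claim is `Shuffle.omits_iff`, applied to the set of vertices of the path hit by the
cell. -/
theorem shuffleHorn_preimage {T : Set (Shuffle (q j.castSucc) (q j.succ))} (hT : IsLowerSet T)
    {s : Shuffle (q j.castSucc) (q j.succ)} (hs : s ∉ T) (hs' : ∀ t < s, t ∈ T) :
    (shuffleHorn q j T).preimage (yoneda.map (horizontalHyperface q j s)) =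
      boxHorn (n := N + 1) (mergeObj q j).q ∅ fun l => {x | l = j ∧ s.IsCorner x.1} := by
  ext ⟨Y⟩ (c : Y ⟶ mergeObj q j)
  change (c ≫ horizontalHyperface q j s) ∈ (shuffleHorn q j T).obj (op Y) ↔ _
  rw [mem_shuffleHorn]
  refine Iff.trans ?_ (mem_boxHorn c).symm
  rw [mem_boxHorn]
  by_cases hc : Function.Surjective c.base.toOrderHom
  swap
  -- If the base of `c` misses a vertex, so does the base of the composite, at a vertex other than
  -- `j + 1`; both sides then hold.
  · simp only [Function.Surjective, not_forall] at hc
    obtain ⟨x, hx⟩ := hc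
    refine iff_of_true (Or.inl (Or.inl ⟨(SimplexCategory.δ j.succ.castSucc).toOrderHom x,
      fun h => (range_delta j).subset ⟨x, rfl⟩ h, ?_⟩)) (Or.inl ⟨x, id, hx⟩)
    rintro ⟨y, hy⟩
    exact hx ⟨y, Fin.succAbove_right_injective hy⟩
  obtain ⟨i₀, h₀⟩ := Covers.exists_of_surjective hc j
  let γ := c.fib i₀ j h₀
  have homits := Shuffle.omits_iff hT hs hs' (Set.range fun x => (γ.toOrderHom x).1) (by
    rintro _ ⟨x, rfl⟩
    exact le_of_mem_fib c h₀ x)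
  -- The contribution of the edges other than the merged one, common to both sides.
  let E : Prop := ∃ l : Fin (N + 1), l ≠ j ∧ ∀ i (h : Covers c.base i l), ∃ x,
    x ∉ Set.range (c.fib i l h).toOrderHom
  have hL : (((∃ x, x ∉ ({j.succ.castSucc} : Set _) ∧
      x ∉ Set.range (c ≫ horizontalHyperface q j s).base.toOrderHom) ∨
      ∃ k, ∀ i h, ∃ x, x ∉ (∅ : Set (Fin (q k + 1))) ∧
        x ∉ Set.range ((c ≫ horizontalHyperface q j s).fib i k h).toOrderHom) ∨
      ∃ t ∈ T, ∃ c', c' ≫ horizontalHyperface q j t = c ≫ horizontalHyperface q j s) ↔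
      E ∨ (∃ x ≤ q j.castSucc, ∀ i ∈ Set.range fun x => (γ.toOrderHom x).1, s.path i ≠ x) ∨
        (∃ y ≤ q j.succ, ∀ i ∈ Set.range fun x => (γ.toOrderHom x).1, i - s.path i ≠ y) ∨
        ∃ t ∈ T, ∀ i ∈ Set.range fun x => (γ.toOrderHom x).1, t.path i = s.path i := by
    constructor
    · rintro ((⟨x, hx, hx'⟩ | ⟨k, hk⟩) | ⟨t, ht, h⟩)
      · obtain ⟨y, rfl⟩ : x ∈ Set.range (SimplexCategory.δ j.succ.castSucc).toOrderHom := by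
          rw [range_delta]
          exact hx
        obtain ⟨z, rfl⟩ := hc y
        exact absurd ⟨z, rfl⟩ hx'
      · rcases eq_succ_or_exists_edge j k with rfl | ⟨l, rfl⟩
        · obtain ⟨x, -, hx⟩ := hk i₀ ((covers_comp_succ_iff s c).2 h₀)
          refine Or.inr (Or.inr (Or.inl ⟨x.1, Nat.lt_succ_iff.1 x.2, ?_⟩))
          rintro _ ⟨z, rfl⟩ hz
          exact hx ⟨z, Fin.ext ((comp_horizontalHyperface_fib_right s c _ h₀ z).trans hz)⟩
        · by_cases hl : l = j
          · replace hl := hl.symm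
            subst hl
            rw [edge_self] at hk
            obtain ⟨x, -, hx⟩ := hk i₀ ((covers_comp_castSucc_iff s c).2 h₀)
            refine Or.inr (Or.inl ⟨x.1, Nat.lt_succ_iff.1 x.2, ?_⟩)
            rintro _ ⟨z, rfl⟩ hz
            exact hx ⟨z, Fin.ext ((comp_horizontalHyperface_fib_left s c _ h₀ z).trans hz)⟩
          · refine Or.inl ⟨l, hl, fun i h => ?_⟩
            obtain ⟨x, -, hx⟩ := hk i ((covers_comp_edge_iff s c).2 h)
            have hx₂ := x.2
            refine ⟨⟨x.1, ?_⟩, ?_⟩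
            · rw [mergeObj_q_of_ne q j hl]
              exact hx₂
            · rintro ⟨z, hz⟩
              exact hx ⟨z, Fin.ext ((comp_horizontalHyperface_fib_edge s c hl _ h z).trans
                (congrArg Fin.val hz))⟩
      · refine Or.inr (Or.inr (Or.inr ⟨t, ht, ?_⟩))
        rintro _ ⟨z, rfl⟩
        exact (comp_horizontalHyperface_eq_iff s t c).1 h i₀ h₀ z
    · rintro (⟨l, hl, hE⟩ | ⟨x, hx, h⟩ | ⟨y, hy, h⟩ | ⟨t, ht, h⟩)
      · refine Or.inl (Or.inr ⟨edge j l, fun i h => ?_⟩)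
        have h' := (covers_comp_edge_iff s c).1 h
        obtain ⟨x, hx⟩ := hE i h'
        have hx₂ := x.2
        refine ⟨⟨x.1, ?_⟩, id, ?_⟩
        · rw [← mergeObj_q_of_ne q j hl]
          exact hx₂
        · rintro ⟨z, hz⟩
          exact hx ⟨z, Fin.ext ((comp_horizontalHyperface_fib_edge s c hl h h' z).symm.trans
            (congrArg Fin.val hz))⟩
      · refine Or.inl (Or.inr ⟨j.castSucc, fun i h' => ⟨⟨x, Nat.lt_succ_iff.2 hx⟩, id, ?_⟩⟩)
        obtain rfl := h₀.unique ((covers_comp_castSucc_iff s c).1 h')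
        rintro ⟨z, hz⟩
        exact h _ ⟨z, rfl⟩ ((comp_horizontalHyperface_fib_left s c h' h₀ z).symm.trans
          (congrArg Fin.val hz))
      · refine Or.inl (Or.inr ⟨j.succ, fun i h' => ⟨⟨y, Nat.lt_succ_iff.2 hy⟩, id, ?_⟩⟩)
        obtain rfl := h₀.unique ((covers_comp_succ_iff s c).1 h')
        rintro ⟨z, hz⟩
        exact h _ ⟨z, rfl⟩ ((comp_horizontalHyperface_fib_right s c h' h₀ z).symm.trans
          (congrArg Fin.val hz))
      · refine Or.inr ⟨t, ht, (comp_horizontalHyperface_eq_iff s t c).2 fun i h' x => ?_⟩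
        obtain rfl := h₀.unique h'
        exact h _ ⟨x, rfl⟩
  have hR : ((∃ x, x ∉ (∅ : Set (Fin (N + 2))) ∧ x ∉ Set.range c.base.toOrderHom) ∨
      ∃ l : Fin (N + 1), ∀ i h, ∃ x : Fin ((mergeObj q j).q l + 1),
        ¬ (l = j ∧ s.IsCorner x.1) ∧
        x ∉ Set.range (c.fib i l h).toOrderHom) ↔
      E ∨ ∃ i ≤ q j.castSucc + q j.succ, ¬ s.IsCorner i ∧
        i ∉ Set.range fun x => (γ.toOrderHom x).1 := by
    constructor
    · rintro (⟨x, -, hx⟩ | ⟨l, hl⟩)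
      · exact absurd (hc x) hx
      · by_cases hlj : l = j
        · replace hlj := hlj.symm
          subst hlj
          obtain ⟨x, hx, hx'⟩ := hl i₀ h₀
          have hx₂ := x.2
          have := mergeObj_q_self q j
          refine Or.inr ⟨x.1, by omega, fun h => hx ⟨rfl, h⟩, ?_⟩
          rintro ⟨z, hz⟩
          exact hx' ⟨z, Fin.ext hz⟩
        · exact Or.inl ⟨l, hlj, fun i h => (hl i h).imp fun x hx => hx.2⟩
    · rintro (⟨l, hlj, hl⟩ | ⟨x, hx, hx', hx''⟩)
      · exact Or.inr ⟨l, fun i h => (hl i h).imp fun x hx => ⟨fun h => hlj h.1, hx⟩⟩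
      · have := mergeObj_q_self q j
        refine Or.inr ⟨j, fun i h => ⟨⟨x, by omega⟩, fun h => hx' h.2, ?_⟩⟩
        obtain rfl := h₀.unique h
        rintro ⟨z, hz⟩
        exact hx'' ⟨z, congrArg Fin.val hz⟩
  exact hL.trans ((or_congr Iff.rfl homits).trans hR.symm)

end

/-! ### The alternative horizontal horns -/

namespace Theta2

theorem IsFace.of_comp {X Y Z : Theta2} {f : X ⟶ Y} {g : Y ⟶ Z} (h : IsFace (f ≫ g)) :
    IsFace f := by
  refine ⟨fun a b hab => h.1 (congrArg g.base.toOrderHom hab), fun l a b hab => h.2 l a b ?_⟩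
  intro k hk
  have hk' : Covers (f.base ≫ g.base) l k := hk
  rw [comp_fib f g l _ k hk hk'.mid_left hk'.mid_right]
  exact congrArg (g.fib _ k hk'.mid_right).toOrderHom (hab _ hk'.mid_left)

/-- Used to show that a hyperface must omit something: an operator bijective on bases and surjective
in each variable cannot raise the dimension. -/
theorem dim_le_of_surjective {Z X : Theta2} (h : Z ⟶ X)
    (hb : Function.Bijective h.base.toOrderHom)
    (hf : ∀ k, ∃ l, ∃ hl : Covers h.base l k, Function.Surjective (h.fib l k hl).toOrderHom) :
    X.dim ≤ Z.dim := by
  obtain ⟨m, p⟩ := Z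
  obtain ⟨n, q⟩ := X
  obtain rfl : m = n := by
    have := Fintype.card_of_bijective hb
    simpa using this
  obtain ⟨base, fib⟩ := h
  have : Mono base := SimplexCategory.mono_iff_injective.2 hb.1
  obtain rfl : base = 𝟙 _ := SimplexCategory.eq_id_of_mono base
  refine Nat.add_le_add_left (Finset.sum_le_sum fun k _ => ?_) _
  obtain ⟨l, hl, hs⟩ := hf k
  obtain rfl : l = k := hl.eq_of_id
  have := Fintype.card_le_of_surjective _ hs
  simpa using this

/-- The equality is one of pairs because the domain itself must be identified. The bases agree in
length, injectivity gives `p l ≤ q l`, and equality of the sums forces `p = q`. -/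
theorem IsFace.eq_id_of_dim_eq {Z X : Theta2} {h : Z ⟶ X} (hh : IsFace h)
    (hb : Function.Surjective h.base.toOrderHom) (hd : Z.dim = X.dim) :
    (⟨Z, h⟩ : Σ Y : Theta2, Y ⟶ X) = ⟨X, 𝟙 X⟩ := by
  obtain ⟨m, p⟩ := Z
  obtain ⟨n, q⟩ := X
  obtain rfl : m = n := by
    have := Fintype.card_of_bijective ⟨hh.1, hb⟩
    simpa using this
  obtain ⟨base, fib⟩ := h
  have : Mono base := SimplexCategory.mono_iff_injective.2 hh.1
  obtain rfl : base = 𝟙 _ := SimplexCategory.eq_id_of_mono base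
  have hinj : ∀ l, Function.Injective (fib l l (Covers.id l)).toOrderHom := fun l a b hab =>
    hh.2 l a b fun k hk => by
      obtain rfl : l = k := hk.eq_of_id
      exact hab
  have hle : ∀ l ∈ Finset.univ, p l ≤ q l := fun l _ => by
    have := Fintype.card_le_of_injective _ (hinj l)
    simpa using this
  obtain rfl : p = q := by
    have := (Finset.sum_eq_sum_iff_of_le hle).1 (Nat.add_left_cancel hd)
    exact funext fun l => this l (Finset.mem_univ l)
  congr 1
  refine Hom.ext' rfl fun l k h h' => ?_
  obtain rfl : l = k := h.eq_of_id
  have : Mono (fib l l h) := SimplexCategory.mono_iff_injective.2 (hinj l)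
  exact SimplexCategory.eq_id_of_mono _

theorem mem_generatedHorn {X Y : Theta2} (S : Set (Σ Y : Theta2, Y ⟶ X)) (c : Y ⟶ X) :
    c ∈ (generatedHorn X S).obj (op Y) ↔
      ∃ (Z : Theta2) (d : Z ⟶ X), IsHyperface d ∧ ⟨Z, d⟩ ∉ S ∧ ∃ c', c' ≫ d = c := by
  rw [generatedHorn, Subfunctor.iSup_obj, Set.mem_iUnion]
  constructor
  · rintro ⟨⟨Z, d⟩, h⟩
    rw [Subfunctor.iSup_obj, Set.mem_iUnion] at h
    obtain ⟨⟨h₁, h₂⟩, h₃⟩ := h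
    exact ⟨Z, d, h₁, h₂, h₃⟩
  · rintro ⟨Z, d, h₁, h₂, h₃⟩
    refine ⟨⟨Z, d⟩, ?_⟩
    rw [Subfunctor.iSup_obj, Set.mem_iUnion]
    exact ⟨⟨h₁, h₂⟩, h₃⟩

theorem isHyperface_vertical {n : ℕ} {q' q : Fin n → ℕ} (φ : ∀ l, ⦋q' l⦌ ⟶ ⦋q l⦌)
    (hφ : ∀ l, Function.Injective (φ l).toOrderHom) (j : Fin n) (i : Fin (q j + 1))
    (hr : ∀ l, Set.range (φ l).toOrderHom = {x | l = j → x.1 ≠ i.1}) :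
    IsHyperface (vertical φ) := by
  refine ⟨isFace_vertical φ hφ, ?_⟩
  have h : ∀ l, q' l + (if l = j then 1 else 0) = q l := fun l => by
    have h₁ : (Set.range (φ l).toOrderHom).ncard = q' l + 1 := by
      rw [← Set.image_univ, Set.ncard_image_of_injective _ (hφ l), Set.ncard_univ]
      simp
    rw [hr l] at h₁
    by_cases hl : l = j
    · subst hl
      have h₂ : ({x | l = l → x.1 ≠ i.1} : Set (Fin (q l + 1))) = {i}ᶜ := by
        ext x
        simp [Fin.ext_iff]
      rw [h₂, Set.ncard_compl, Set.ncard_singleton, Nat.card_fin, SimplexCategory.len_mk] at h₁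
      rw [if_pos rfl]
      omega
    · have h₂ : ({x | l = j → x.1 ≠ i.1} : Set (Fin (q l + 1))) = Set.univ := by
        ext x
        simp [hl]
      rw [h₂, Set.ncard_univ, Nat.card_fin, SimplexCategory.len_mk] at h₁
      rw [if_neg hl]
      omega
  have hs : ∑ l, q l = ∑ l, q' l + 1 := by
    rw [← Finset.sum_congr rfl fun l _ => h l, Finset.sum_add_distrib]
    simp
  change n + ∑ l, q' l + 1 = n + ∑ l, q l
  omega

/-! ### Outer horizontal faces -/

variable {N : ℕ} {q : Fin (N + 2) → ℕ}

/-- The face of `[n; q]` with underlying simplicial operator `δˣ`, where `x` is the first or the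
last vertex and `y` is the first or the last edge, respectively. -/
noncomputable def outerFace (q : Fin (N + 2) → ℕ) (x : Fin (N + 3)) (y : Fin (N + 2))
    (he : ∀ l k, Covers (SimplexCategory.δ x) l k ↔ k = y.succAbove l) :
    (⟨N + 1, fun l => q (y.succAbove l)⟩ : Theta2) ⟶ (⟨N + 2, q⟩ : Theta2) where
  base := SimplexCategory.δ x
  fib l k h := eqToHom (congrArg (fun t => ⦋q t⦌) ((he l k).1 h).symm)

/-- Deleting the outer edge `y` lowers the dimension by `1 + q y`, so this is a hyperface only
because `q y = 0`. -/
theorem isHyperface_outerFace (x : Fin (N + 3)) (y : Fin (N + 2))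
    (he : ∀ l k, Covers (SimplexCategory.δ x) l k ↔ k = y.succAbove l) (hy : q y = 0) :
    IsHyperface (outerFace q x y he) := by
  refine ⟨⟨fun a b h => Fin.succAbove_right_injective h, fun l a b h => ?_⟩, ?_⟩
  · have := congrArg Fin.val (h (y.succAbove l) ((he _ _).2 rfl))
    exact Fin.ext (by simpa [outerFace] using this)
  · change N + 1 + ∑ l, q (y.succAbove l) + 1 = N + 2 + ∑ k, q k
    rw [Fin.sum_univ_succAbove q y]
    omega

theorem exists_comp_outerFace (x : Fin (N + 3)) (y : Fin (N + 2))
    (he : ∀ l k, Covers (SimplexCategory.δ x) l k ↔ k = y.succAbove l) {Y : Theta2}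
    (c : Y ⟶ (⟨N + 2, q⟩ : Theta2)) (hc : x ∉ Set.range c.base.toOrderHom) :
    ∃ c', c' ≫ outerFace q x y he = c := by
  obtain ⟨u, hu⟩ := SimplexCategory.exists_lift_of_range_subset c.base
    (SimplexCategory.δ (n := N + 1) x) Fin.succAbove_right_injective (by
      rw [show Set.range (SimplexCategory.δ (n := N + 1) x).toOrderHom = {x}ᶜ from
        Fin.range_succAbove x]
      rintro _ ⟨z, rfl⟩ h
      exact hc ⟨z, h⟩)
  refine exists_factor (outerFace q x y he) c u hu fun i l h =>
    ⟨c.fib i (y.succAbove l) (hu ▸ h.comp ((he _ _).2 rfl)), fun k h' h'' => ?_⟩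
  obtain rfl : k = y.succAbove l := (he _ _).1 h'
  exact Category.comp_id _

theorem covers_delta_zero_iff (l : Fin (N + 1)) (k : Fin (N + 2)) :
    Covers (SimplexCategory.δ 0) l k ↔ k = (0 : Fin (N + 2)).succAbove l := by
  simp only [Covers, SimplexCategory.δ, SimplexCategory.mkHom, SimplexCategory.Hom.toOrderHom_mk,
    OrderEmbedding.toOrderHom_coe, Fin.succAboveOrderEmb_apply, Fin.zero_succAbove, Fin.le_def,
    Fin.val_castSucc, Fin.val_succ, Fin.ext_iff]
  omega

theorem covers_delta_last_iff (l : Fin (N + 1)) (k : Fin (N + 2)) :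
    Covers (SimplexCategory.δ (Fin.last (N + 2))) l k ↔
      k = (Fin.last (N + 1)).succAbove l := by
  simp only [Covers, SimplexCategory.δ, SimplexCategory.mkHom, SimplexCategory.Hom.toOrderHom_mk,
    OrderEmbedding.toOrderHom_coe, Fin.succAboveOrderEmb_apply, Fin.succAbove_last, Fin.le_def,
    Fin.val_castSucc, Fin.val_succ, Fin.ext_iff]
  omega

/-! ### Cells of the alternative horn -/

variable {j : Fin (N + 1)} (s : Shuffle (q j.castSucc) (q j.succ))

theorem ne_horizontalHyperface {Z : Theta2} (d : Z ⟶ (⟨N + 2, q⟩ : Theta2))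
    (h : j.succ.castSucc ∈ Set.range d.base.toOrderHom) :
    (⟨Z, d⟩ : Σ Y : Theta2, Y ⟶ (⟨N + 2, q⟩ : Theta2)) ∉
      ({⟨_, horizontalHyperface q j s⟩} : Set _) := by
  intro he
  have : Set.range d.base.toOrderHom = Set.range (horizontalHyperface q j s).base.toOrderHom :=
    congrArg (fun t : Σ Y : Theta2, Y ⟶ (⟨N + 2, q⟩ : Theta2) => Set.range t.2.base.toOrderHom) he
  rw [this] at h
  exact (range_delta j).subset h rfl

theorem mem_generatedHorn_of_fib {Y : Theta2} (c : Y ⟶ (⟨N + 2, q⟩ : Theta2)) (k : Fin (N + 2))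
    (hk : 0 < q k) (x : Fin (q k + 1))
    (hc : ∀ l h, x ∉ Set.range (c.fib l k h).toOrderHom) :
    c ∈ (generatedHorn ⟨N + 2, q⟩ {⟨_, horizontalHyperface q j s⟩}).obj (op Y) := by
  obtain ⟨q', φ, hφ, hr⟩ := exists_vertical_omitting q k x hk
  refine (mem_generatedHorn _ _).2 ⟨_, vertical φ, isHyperface_vertical φ hφ k x hr,
    ne_horizontalHyperface s _ ⟨_, rfl⟩, (exists_comp_vertical_iff φ hφ c).2 fun l k' h => ?_⟩
  rw [hr k']
  rintro _ ⟨z, rfl⟩ rfl hz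
  exact hc l h ⟨z, Fin.ext hz⟩

/-- If `q y > 0`, the outer face is not a hyperface. However, a cell not involving the edge `y` lies
in every vertical hyperface in the `y`-th variable. -/
theorem mem_generatedHorn_of_outer {Y : Theta2} (c : Y ⟶ (⟨N + 2, q⟩ : Theta2)) (x : Fin (N + 3))
    (y : Fin (N + 2)) (he : ∀ l k, Covers (SimplexCategory.δ x) l k ↔ k = y.succAbove l)
    (hx : x ≠ j.succ.castSucc) (hc : x ∉ Set.range c.base.toOrderHom)
    (hy : ∀ l, ¬ Covers c.base l y) :
    c ∈ (generatedHorn ⟨N + 2, q⟩ {⟨_, horizontalHyperface q j s⟩}).obj (op Y) := by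
  by_cases hq : q y = 0
  · refine (mem_generatedHorn _ _).2 ⟨_, outerFace q x y he, isHyperface_outerFace x y he hq,
      ne_horizontalHyperface s _ ?_, exists_comp_outerFace x y he c hc⟩
    change _ ∈ Set.range x.succAbove
    rw [Fin.range_succAbove]
    exact hx.symm
  · exact mem_generatedHorn_of_fib s c y (Nat.pos_of_ne_zero hq) 0 fun l h => absurd h (hy l)

theorem mem_generatedHorn_of_base {Y : Theta2} (c : Y ⟶ (⟨N + 2, q⟩ : Theta2)) (x : Fin (N + 3))
    (hx : x ≠ j.succ.castSucc) (hc : x ∉ Set.range c.base.toOrderHom) :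
    c ∈ (generatedHorn ⟨N + 2, q⟩ {⟨_, horizontalHyperface q j s⟩}).obj (op Y) := by
  by_cases h0 : x = 0
  · subst h0
    refine mem_generatedHorn_of_outer s c 0 0 covers_delta_zero_iff hx hc fun l h =>
      hc ⟨l.castSucc, ?_⟩
    exact le_antisymm h.1 (Fin.zero_le _)
  by_cases h1 : x = Fin.last _
  · subst h1
    refine mem_generatedHorn_of_outer s c _ _ covers_delta_last_iff hx hc fun l h =>
      hc ⟨l.succ, ?_⟩
    exact le_antisymm (Fin.le_last _) h.2
  obtain ⟨x, rfl⟩ := Fin.exists_castSucc_eq.2 h1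
  obtain ⟨i, rfl⟩ := Fin.exists_succ_eq.2 (show x ≠ 0 by rintro rfl; exact h0 rfl)
  obtain ⟨t, h⟩ := exists_mem_range_horizontalHyperface c hc
  refine (mem_generatedHorn _ _).2 ⟨_, _, isHyperface_horizontalHyperface t,
    ne_horizontalHyperface s _ ?_, h⟩
  change _ ∈ Set.range (SimplexCategory.δ (n := N + 1) i.succ.castSucc).toOrderHom
  rw [range_delta]
  exact hx.symm

/-- Comparing the two hyperfaces on the identity cell makes the paths agree at every position. -/
theorem horizontalHyperface_injective {s t : Shuffle (q j.castSucc) (q j.succ)}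
    (h : horizontalHyperface q j s = horizontalHyperface q j t) : s = t := by
  refine Shuffle.ext_path fun i hi => ?_
  have h' := (comp_horizontalHyperface_eq_iff t s (𝟙 _)).1 ⟨𝟙 _, by rw [h]⟩ j (Covers.id j)
    ⟨i, by rw [mergeObj_q_self]; exact Nat.lt_succ_iff.2 hi⟩
  have e : (((𝟙 (mergeObj q j) : mergeObj q j ⟶ mergeObj q j).fib j j (Covers.id j)).toOrderHom
      ⟨i, by rw [mergeObj_q_self]; exact Nat.lt_succ_iff.2 hi⟩).1 = i := by
    have he : (𝟙 (mergeObj q j) : mergeObj q j ⟶ mergeObj q j).fib j j (Covers.id j) = 𝟙 _ :=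
      rfl
    rw [he]
    rfl
  rwa [e] at h'

/-- The base case of the filtration: once all shuffles but `s` are attached, precisely the hyperface
of `s` is missing. -/
theorem shuffleHorn_compl_singleton :
    shuffleHorn q j {s}ᶜ = generatedHorn ⟨N + 2, q⟩ {⟨_, horizontalHyperface q j s⟩} := by
  apply le_antisymm
  · rintro ⟨Y⟩ (c : Y ⟶ (⟨N + 2, q⟩ : Theta2)) hc
    rcases (mem_shuffleHorn c).1 hc with hc | ⟨t, ht, h⟩
    · rcases (mem_boxHorn c).1 hc with ⟨x, hx, hx'⟩ | ⟨k, hk⟩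
      · exact mem_generatedHorn_of_base s c x hx hx'
      · by_cases h : ∃ l, Covers c.base l k
        · obtain ⟨l, h⟩ := h
          obtain ⟨x, -, hx⟩ := hk l h
          refine mem_generatedHorn_of_fib s c k ?_ x fun l' h' => ?_
          · by_contra hq
            refine hx ⟨0, ?_⟩
            have : Subsingleton (Fin (q k + 1)) :=
              Fin.subsingleton_iff_le_one.2 (by omega)
            exact Subsingleton.elim _ _
          · obtain rfl := h.unique h'
            exact hx
        -- If no edge covers `k`, the base cannot hit both the first and the last vertex, and
        -- neither of these is `j + 1`.
        · by_cases h0 : (0 : Fin (N + 3)) ∈ Set.range c.base.toOrderHom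
          · refine mem_generatedHorn_of_base s c (Fin.last _) (Fin.castSucc_lt_last _).ne' ?_
            rintro ⟨b, hb⟩
            obtain ⟨a, ha⟩ := h0
            exact h (Covers.exists_of_mem_range (ha.trans_le (Fin.zero_le _))
              ((Fin.le_last _).trans hb.ge))
          · exact mem_generatedHorn_of_base s c 0 (fun h => absurd (congrArg Fin.val h) (by simp)) h0
    · refine (mem_generatedHorn _ _).2 ⟨_, _, isHyperface_horizontalHyperface t, fun he => ?_, h⟩
      exact ht (horizontalHyperface_injective (eq_of_heq (Sigma.mk.inj he).2))
  · refine iSup_le fun ⟨Z, d⟩ => iSup_le fun ⟨hd, hne⟩ => ?_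
    have hmem : d ∈ (shuffleHorn q j {s}ᶜ).obj (op Z) := by
      rw [mem_shuffleHorn, or_iff_not_imp_left, mem_boxHorn]
      intro hn
      push Not at hn
      obtain ⟨h₁, h₂⟩ := hn
      by_cases hk : j.succ.castSucc ∈ Set.range d.base.toOrderHom
      · have hs : Function.Surjective d.base.toOrderHom := fun x => by
          by_cases hx : x = j.succ.castSucc
          · rw [hx]
            exact hk
          · exact h₁ x hx
        -- Outside the horn and with `j + 1` in its range, `d` would be surjective in every respect,
        -- contradicting codimension one.
        have := dim_le_of_surjective d ⟨hd.1.1, hs⟩ fun k => by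
          obtain ⟨l, h, hx⟩ := h₂ k
          exact ⟨l, h, fun x => hx x id⟩
        have h₃ : Z.dim + 1 = dim ⟨N + 2, q⟩ := hd.2
        omega
      · obtain ⟨t, c, rfl⟩ := exists_mem_range_horizontalHyperface d hk
        refine ⟨t, ?_, c, rfl⟩
        rintro rfl
        have hs : Function.Surjective c.base.toOrderHom := fun y => by
          obtain ⟨z, hz⟩ := h₁ ((SimplexCategory.δ j.succ.castSucc).toOrderHom y)
            fun h => (range_delta j).subset ⟨y, rfl⟩ h
          exact ⟨z, Fin.succAbove_right_injective hz⟩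
        have hdim : Z.dim = (mergeObj q j).dim := by
          have h₁ : Z.dim + 1 = dim ⟨N + 2, q⟩ := hd.2
          have h₂ := dim_mergeObj q j
          omega
        -- A hyperface factoring through that of `s` does so by a face of equal dimension, hence by
        -- the identity, and so is the excluded one.
        have := hd.1.of_comp.eq_id_of_dim_eq hs hdim
        obtain ⟨rfl, h⟩ := Sigma.mk.inj this
        rw [eq_of_heq h, Category.id_comp] at hne
        exact hne rfl
    rintro ⟨Y⟩ c ⟨c', rfl⟩
    exact (shuffleHorn q j {s}ᶜ).map (Quiver.Hom.op c') hmem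

end Theta2

/-! ### The main result -/

instance (a b : ℕ) : Finite (Shuffle a b) :=
  Finite.of_injective (fun s (i : Fin (a + b + 1)) => (s.left.toOrderHom i : Fin (a + 1)))
    fun s t h => Shuffle.ext_path fun i hi => by
      have := congrArg Fin.val (congrFun h ⟨i, Nat.lt_succ_iff.2 hi⟩)
      rwa [Shuffle.path_val, Shuffle.path_val] at this

/-- Induction on the number of shuffles not yet attached. Taking `s` minimal among them keeps `T` a
lower set and provides the hypotheses of `shuffleHorn_preimage`. -/
theorem shuffleHorn_ι_mem (P : MorphismProperty CellSet) [P.IsStableUnderCobaseChange]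
    [P.IsStableUnderComposition]
    (hv : (innerVerticalHorns : MorphismProperty CellSet) ≤ P)
    (hh : (alternativeHorizontalHorns : MorphismProperty CellSet) ≤ P)
    {N : ℕ} (q : Fin (N + 2) → ℕ) (j : Fin (N + 1)) (r : ℕ) :
    ∀ T : Set (Shuffle (q j.castSucc) (q j.succ)), IsLowerSet T → Tᶜ.ncard = r + 1 →
      P (shuffleHorn q j T).ι := by
  induction r with
  | zero =>
    intro T hT hc
    obtain ⟨s, hs⟩ := Set.ncard_eq_one.1 hc
    obtain rfl : T = {s}ᶜ := by rw [← hs, compl_compl]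
    rw [shuffleHorn_compl_singleton]
    exact hh _ _ _ (alternativeHorizontalHorns.mk N q j s)
  | succ r ih =>
    intro T hT hc
    have hne : Tᶜ.Nonempty := Set.nonempty_of_ncard_ne_zero (by omega)
    obtain ⟨s, hs⟩ := Set.Finite.exists_minimal (Set.toFinite Tᶜ) hne
    have hs' : ∀ t < s, t ∈ T := fun t ht => by
      by_contra h
      exact hs.not_lt h ht
    -- At least two shuffles remain. By minimality of `s`, another one `t` is not below `s`, so `s`
    -- has a corner and the vertical horn really lacks a face.
    obtain ⟨t, ht, hts⟩ := Set.exists_ne_of_one_lt_ncard (s := Tᶜ) (by omega) s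
    obtain ⟨i, hi⟩ : ∃ i, s.IsCorner i := Shuffle.exists_isCorner (t := t) fun h =>
      hts (le_antisymm h (hs.le_of_le ht h))
    have := (isFace_horizontalHyperface s).mono
    refine P.subfunctor_ι_of_glue (yoneda.map (horizontalHyperface q j s))
      (shuffleHorn_insert s T) ?_ (ih _ ?_ ?_)
    · rw [shuffleHorn_preimage hT hs.prop hs']
      have hm := mergeObj_q_self q j
      let R : ∀ l : Fin (N + 1), Set (Fin ((mergeObj q j).q l + 1)) :=
        fun l => {x | l = j ∧ s.IsCorner x.1}
      have hR : (R j).Nonempty := by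
        have hi' := hi
        obtain ⟨m, rfl, hm', -⟩ := hi'
        exact ⟨⟨m + 1, by omega⟩, rfl, hi⟩
      obtain ⟨r', hr'⟩ := Nat.exists_eq_succ_of_ne_zero
        ((Set.ncard_pos).2 hR).ne'
      refine boxHorn_ι_mem_of_innerVerticalHorns P hv r' (n := N + 1) (mergeObj q j).q j R hr'
        ?_ ?_ ?_
      -- A corner has the form `m + 1` with `m + 1 < a + b`, hence is neither the first nor the last
      -- vertex.
      · rintro ⟨-, m, h, -⟩
        exact absurd h (by simp)
      · rintro ⟨-, m, h, h', -⟩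
        simp only [Fin.val_last] at h
        omega
      · intro l hl
        exact Set.eq_empty_of_forall_notMem fun x hx => hl hx.1
    · rintro a b hba (rfl | ha)
      · rcases hba.eq_or_lt with rfl | h
        · exact Set.mem_insert _ _
        · exact Set.mem_insert_of_mem _ (hs' _ h)
      · exact Set.mem_insert_of_mem _ (hT hba ha)
    · have : (insert s T)ᶜ = Tᶜ \ {s} := by
        ext x
        simp [not_or, and_comm]
      rw [this, Set.ncard_sdiff_singleton_of_mem hs.prop, hc]
      rfl

theorem mainTheorem8 :
    (innerHorizontalHorns : MorphismProperty CellSet) ≤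
      cellClosure ((alternativeHorizontalHorns : MorphismProperty CellSet) ⊔
        (innerVerticalHorns : MorphismProperty CellSet)) := by
  rintro X Y f ⟨n, q, k, h₀, h₁⟩
  rw [cellClosure, MorphismProperty.sInf_iff]
  -- The closure is an intersection, so it suffices to treat each class `P` closed under the
  -- operations.
  rintro P ⟨hW, hP, hP'⟩
  have := MorphismProperty.IsStableUnderCobaseChange.respectsIso (P := P)
  have hP'' : P.IsStableUnderComposition := inferInstance
  rw [innerHorizontalHorns_iff q k P]
  obtain ⟨N, rfl⟩ : ∃ N, n = N + 2 := ⟨n - 2, by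
    have h₂ : 0 < k.1 := h₀
    have h₃ : k.1 < n := h₁
    omega⟩
  obtain ⟨k, rfl⟩ := Fin.exists_castSucc_eq.2 h₁.ne
  obtain ⟨j, rfl⟩ := Fin.exists_succ_eq.2 (show k ≠ 0 by rintro rfl; exact lt_irrefl _ h₀)
  rw [← shuffleHorn_empty]
  -- Some shuffle exists, so the filtration starting at `T = ∅` has at least one hyperface to
  -- attach.
  obtain ⟨s, -⟩ := Shuffle.exists_path_through (a := q j.castSucc) (b := q j.succ) (p := 0)
    (fun _ => 0) (fun _ => 0) (fun _ _ _ => le_rfl) (fun _ _ _ => le_rfl)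
    (fun _ => Nat.zero_le _) (fun _ => Nat.zero_le _)
  obtain ⟨r, hr⟩ := Nat.exists_eq_succ_of_ne_zero ((Set.ncard_pos
    (s := (∅ : Set (Shuffle (q j.castSucc) (q j.succ)))ᶜ)).2 ⟨s, id⟩).ne'
  exact shuffleHorn_ι_mem P (le_sup_right.trans hW) (le_sup_left.trans hW) q j r ∅
    isLowerSet_empty hr
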